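/- Let $1\le d\le q$ be integers and let $\vec n=(n_1,\dots,n_q)$ with all $n_i\ge 2$; put $|\vec n|=\prod_{i=1}^q n_i$ and $V=\prod_{i=1}^q\mathbb Z/n_i\mathbb Z$. For $0\le k\le q$ let $Y_k$ be the set of $k$-cubes of the periodic cubical lattice with side lengths $\vec n$, i.e. of the sets $I_1\times\cdots\times I_q\subset\prod_i\mathbb R/n_i\mathbb Z$, where for exactly $k$ indices $I_i=[v_i,v_i+1]$ and for the others $I_i=[v_i,v_i]$, with $v_i\in\mathbb Z/n_i\mathbb Z$. Thus $Y_k$ is identified with the set of pairs $(\sigma,\mathbf v)$, where $\sigma\subset\{1,\dots,q\}$, $|\sigma|=k$ and $\mathbf v\in V$. Let $Y^{(d)}$ be the $d$-skeleton $\bigsqcup_{k\le d}Y_k$. A closed geodesic of length $m\ge 1$ in $Y^{(d)}$ is a sequence $(\tau_0,\sigma_0,\dots,\tau_{m-1},\sigma_{m-1})$, indexed by $\mathbb Z/m\mathbb Z$, with $\tau_i\in Y_{d-1}$, $\sigma_i\in Y_d$, $\tau_i\ne\tau_{i+1}$, $\sigma_i\ne\sigma_{i+1}$ and $\tau_{i+1}\subset\sigma_i\cap\sigma_{i+1}$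 for all $i$. It is prime if it is not the $k$-fold repetition of a closed geodesic for any $k\ge2$. A prime cycle $\mathfrak p$ is a class of prime closed geodesics up to cyclic permutation, and $|\mathfrak p|$ is its length. For $u\in\mathbb C$ with $|u|$ sufficiently small put $\zeta_{Y^{(d)}}(u)=\prod_{\mathfrak p}(1-u^{|\mathfrak p|})^{-1}$, the product being over all prime cycles of $Y^{(d)}$. Let $C^k$ be the space of functions $Y_k\to\mathbb C$, and let $S_j\mathbf v=(v_1,\dots,v_j+1,\dots,v_q)$. Define $M_k:C^k\to C^{k+1}$ by $$M_kf(\eta,\mathbf v)=\sum_{j\in\eta}\{f(\eta\setminus\{j\},\mathbf v)+f(\eta\setminus\{j\},S_j\mathbf v)\}$$ and let $M_k^*:C^{k+1}\to C^k$ be its dual for the standard inner products $\langle f,g\rangle=|V|^{-1}\sum_{\sigma,\mathbf v}f(\sigma,\mathbf v)\overline{g(\sigma,\mathbf v)}$. Let $\hat V$ be the set of $\mathbf z=(z_1,\dots,z_q)\in\mathbb C^q$ with $z_j^{n_j}=1$ for all $j$ (the characters of $V$). For $\mathbf z\in\hat V$ let $C^k_{\mathbf z}=\{f\in C^k: f(\sigma,S_j\mathbf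 v)=z_jf(\sigma,\mathbf v)\text{ for all }j,\sigma,\mathbf v\}$. The operators $M_k$ and $M_k^*$ restrict to operators $M_k(\mathbf z):C^k_{\mathbf z}\to C^{k+1}_{\mathbf z}$ and $M_k^*(\mathbf z):C^{k+1}_{\mathbf z}\to C^k_{\mathbf z}$. Put $A^{\mathrm{up}}_{d-1}(\mathbf z)=M_{d-1}^*(\mathbf z)M_{d-1}(\mathbf z)$ on $C^{d-1}_{\mathbf z}$ and $A^{\mathrm{down}}_d(\mathbf z)=M_{d-1}(\mathbf z)M_{d-1}^*(\mathbf z)$ on $C^d_{\mathbf z}$. Let $\alpha_d=2q-2d+1$, $\beta_d=2d-1$, $\gamma_d=\binom qd-\binom q{d-1}$ and $\kappa_d=(q-d)\binom q{d-1}+(d-1)\binom qd$. Then for all $u\in\mathbb C$ with $|u|$ sufficiently small, the product defining $\zeta_{Y^{(d)}}(u)$ converges unconditionally to a non-zero number, and $$\zeta_{Y^{(d)}}(u)^{-1}=(1-u)^{\kappa_d|\vec n|}(1+\beta_du)^{\gamma_d|\vec n|}\prod_{\mathbf z\in\hat V}\det\Big((1+\alpha_du)(1+\beta_du)I-uA^{\mathrm{up}}_{d-1}(\mathbf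 z)\Big)$$ $$=(1-u)^{\kappa_d|\vec n|}(1+\alpha_du)^{-\gamma_d|\vec n|}\prod_{\mathbf z\in\hat V}\det\Big((1+\alpha_du)(1+\beta_du)I-uA^{\mathrm{down}}_d(\mathbf z)\Big).$$ -/

import Mathlib

namespace CubicalLattice

variable {q : ℕ}

/-! ### The periodic cubical lattice -/

/-- `Cell q d` is the set `K_{d-1}` of faces with `d` vertices of the complete simplicial complex
`K` on `q` vertices. -/
abbrev Cell (q d : ℕ) : Type := {σ : Finset (Fin q) // σ.card = d}

/-- The group `V = ℤ/n₁ × ⋯ × ℤ/n_q`. -/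
abbrev Torus (n : Fin q → ℕ) : Type := ∀ i, ZMod (n i)

/-- The set `Y_d` of `d`-cubes `I₁ × ⋯ × I_q`: the pair `(σ, v)` stands for the cube with
`I_i = [v_i, v_i + 1]` for `i ∈ σ` and `I_i = [v_i, v_i]` for `i ∉ σ`. -/
abbrev Cube (n : Fin q → ℕ) (d : ℕ) : Type := Cell q d × Torus n

/-- The elementary interval `[v, v + 1]` in `ℝ/mℤ`. -/
def edge (m : ℕ) (v : ZMod m) : Set (AddCircle (m : ℝ)) :=
  (fun t : ℝ => (t : AddCircle (m : ℝ))) '' Set.Icc (v.val : ℝ) (v.val + 1)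

/-- The degenerate elementary interval `[v, v]` in `ℝ/mℤ`. -/
def point (m : ℕ) (v : ZMod m) : Set (AddCircle (m : ℝ)) :=
  {(((v.val : ℝ)) : AddCircle (m : ℝ))}

/-- The cube, as a subset `I₁ × ⋯ × I_q` of the torus `∏ ℝ/n_iℤ`. -/
def carrier {n : Fin q → ℕ} {d : ℕ} (c : Cube n d) : Set (∀ i, AddCircle (n i : ℝ)) :=
  Set.pi Set.univ fun i => if i ∈ c.1.1 then edge (n i) (c.2 i) else point (n i) (c.2 i)

/-! ### Closed geodesics, prime cycles and the zeta function -/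

/-- Closed paths `(τ₀, σ₀, …, τ_{m-1}, σ_{m-1})` of `(d-1)`-cubes and `d`-cubes, indexed by `ℤ/mℤ`,
where `m ≥ 1` is the length. -/
structure ClosedPath (n : Fin q → ℕ) (d : ℕ) where
  length : ℕ
  length_pos : 0 < length
  τ : ZMod length → Cube n (d - 1)
  σ : ZMod length → Cube n d
  ne : ∀ i, τ i ≠ τ (i + 1)
  subset : ∀ i, carrier (τ (i + 1)) ⊆ carrier (σ i) ∩ carrier (σ (i + 1))

namespace ClosedPath

variable {n : Fin q → ℕ} {d : ℕ}

/-- A closed geodesic is a closed path without back-tracking. -/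
def IsGeodesic (c : ClosedPath n d) : Prop := ∀ i, c.σ i ≠ c.σ (i + 1)

/-- `c'` is the `m`-multiple `c^m`, i.e. `c` repeated `m` times. -/
def IsMultiple (c' : ClosedPath n d) (m : ℕ) (c : ClosedPath n d) : Prop :=
  c'.length = m * c.length ∧ ∀ i : ℕ, c'.τ i = c.τ i ∧ c'.σ i = c.σ i

/-- A prime closed geodesic is one that is not an `m`-multiple of a closed geodesic, `m ≥ 2`. -/
def IsPrime (c : ClosedPath n d) : Prop :=
  c.IsGeodesic ∧ ¬ ∃ (m : ℕ) (c₀ : ClosedPath n d), 2 ≤ m ∧ c₀.IsGeodesic ∧ c.IsMultiple m c₀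

/-- `c'` is a cyclic permutation of `c`. -/
def IsCyclicPerm (c c' : ClosedPath n d) : Prop :=
  c.length = c'.length ∧
    ∃ k : ℤ, ∀ i : ℤ, c'.τ i = c.τ ((i + k : ℤ)) ∧ c'.σ i = c.σ ((i + k : ℤ))

theorem IsCyclicPerm.refl (c : ClosedPath n d) : c.IsCyclicPerm c :=
  ⟨rfl, 0, fun i => by simp⟩

theorem IsCyclicPerm.symm {c c' : ClosedPath n d} (h : c.IsCyclicPerm c') :
    c'.IsCyclicPerm c := by
  obtain ⟨hl, k, hk⟩ := h
  refine ⟨hl.symm, -k, fun i => ?_⟩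
  have := hk (i + -k)
  rw [neg_add_cancel_right] at this
  exact ⟨this.1.symm, this.2.symm⟩

theorem IsCyclicPerm.trans {c c' c'' : ClosedPath n d} (h : c.IsCyclicPerm c')
    (h' : c'.IsCyclicPerm c'') : c.IsCyclicPerm c'' := by
  obtain ⟨hl, k, hk⟩ := h
  obtain ⟨hl', k', hk'⟩ := h'
  refine ⟨hl.trans hl', k' + k, fun i => ?_⟩
  have h1 := hk' i
  have h2 := hk (i + k')
  rw [add_assoc] at h2
  exact ⟨h1.1.trans h2.1, h1.2.trans h2.2⟩

end ClosedPath

/-- Cyclic permutation as an equivalence relation on the prime closed geodesics. -/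
instance primeSetoid (n : Fin q → ℕ) (d : ℕ) : Setoid {c : ClosedPath n d // c.IsPrime} where
  r c c' := c.1.IsCyclicPerm c'.1
  iseqv := ⟨fun c => .refl c.1, fun h => ClosedPath.IsCyclicPerm.symm h,
    fun h h' => ClosedPath.IsCyclicPerm.trans h h'⟩

/-- The set `P_d` of prime cycles of the `d`-skeleton. -/
def PrimeCycle (n : Fin q → ℕ) (d : ℕ) : Type := Quotient (primeSetoid n d)

/-- The length of a prime cycle. -/
def PrimeCycle.length {n : Fin q → ℕ} {d : ℕ} (p : PrimeCycle n d) : ℕ :=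
  Quotient.lift (fun c : {c : ClosedPath n d // c.IsPrime} => c.1.length) 
    (fun a b (h : ClosedPath.IsCyclicPerm a.1 b.1) => h.1) p

/-- The Ihara zeta function of the `d`-skeleton `Y^{(d)}` (for `u` small). -/
noncomputable def zeta (n : Fin q → ℕ) (d : ℕ) (u : ℂ) : ℂ :=
  ∏' p : PrimeCycle n d, (1 - u ^ p.length)⁻¹

/-! ### Incidence operators and twisted adjacency operators -/

/-- The space `C^d(Y)` of `d`-cochains. -/
abbrev Cochain (n : Fin q → ℕ) (d : ℕ) : Type := Cube n d → ℂ

/-- The face `η_j = η \ {j}` for `j ∈ η`. -/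
def Cell.del {d : ℕ} (η : Cell q (d + 1)) (j : {j : Fin q // j ∈ η.1}) : Cell q d :=
  ⟨η.1.erase j.1, by rw [Finset.card_erase_of_mem j.2, η.2]; rfl⟩

/-- The coface `σ ∪ {j}` for `j ∉ σ`. -/
def Cell.add {d : ℕ} (σ : Cell q d) (j : {j : Fin q // j ∉ σ.1}) : Cell q (d + 1) :=
  ⟨insert j.1 σ.1, by rw [Finset.card_insert_of_notMem j.2, σ.2]⟩

/-- The shift `S_j v = (v₁, …, v_j + 1, …, v_q)`. -/
def shift {n : Fin q → ℕ} (j : Fin q) (v : Torus n) : Torus n := v + Pi.single j 1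

/-- The inverse shift `S_j⁻¹ v = (v₁, …, v_j - 1, …, v_q)`. -/
def shiftInv {n : Fin q → ℕ} (j : Fin q) (v : Torus n) : Torus n := v - Pi.single j 1

/-- The incidence operator `M_d : C^d(Y) → C^{d+1}(Y)`. -/
def incid (n : Fin q → ℕ) (d : ℕ) : Cochain n d →ₗ[ℂ] Cochain n (d + 1) where
  toFun f := fun c => ∑ j : {j : Fin q // j ∈ c.1.1},
    (f (c.1.del j, c.2) + f (c.1.del j, shift j.1 c.2))
  map_add' f g := by
    funext c
    simp only [Pi.add_apply, ← Finset.sum_add_distrib]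
    exact Finset.sum_congr rfl fun _ _ => by ring
  map_smul' a f := by
    funext c
    simp [Finset.mul_sum, mul_add]

/-- The dual operator `M_d^* : C^{d+1}(Y) → C^d(Y)` of `M_d`; see `incid_dual`. -/
def incidStar (n : Fin q → ℕ) (d : ℕ) : Cochain n (d + 1) →ₗ[ℂ] Cochain n d where
  toFun f := fun c => ∑ j : {j : Fin q // j ∉ c.1.1},
    (f (c.1.add j, c.2) + f (c.1.add j, shiftInv j.1 c.2))
  map_add' f g := by
    funext c
    simp only [Pi.add_apply, ← Finset.sum_add_distrib]
    exact Finset.sum_congr rfl fun _ _ => by ring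
  map_smul' a f := by
    funext c
    simp [Finset.mul_sum, mul_add]

/-- The dual group of `V`, a tuple of characters being identified with the tuple
`z = (z₁, …, z_q)` of their values at `1`, where `z_j` is an `n_j`-th root of unity. -/
abbrev DualGroup (n : Fin q → ℕ) : Type := ∀ i, rootsOfUnity (n i) ℂ

noncomputable instance (n : Fin q → ℕ) [∀ i, NeZero (n i)] : Fintype (DualGroup n) :=
  Fintype.ofFinite _

/-- The subspace `C^d_z = {f ∈ C^d(Y) : S_j f = z_j f for all j}`. -/
def fiber (n : Fin q → ℕ) (d : ℕ) (z : DualGroup n) : Submodule ℂ (Cochain n d) where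
  carrier := {f | ∀ (j : Fin q) (σ : Cell q d) (v : Torus n),
    f (σ, shift j v) = ((z j : ℂˣ) : ℂ) * f (σ, v)}
  add_mem' hf hg j σ v := by simp only [Pi.add_apply, hf j σ v, hg j σ v, mul_add]
  zero_mem' j σ v := by simp
  smul_mem' a f hf j σ v := by
    simp only [Pi.smul_apply, smul_eq_mul, hf j σ v]; ring

theorem incid_mem_fiber {n : Fin q → ℕ} {d : ℕ} {z : DualGroup n} (f : Cochain n d)
    (hf : f ∈ fiber n d z) : incid n d f ∈ fiber n (d + 1) z := by
  intro j η v
  simp only [incid, LinearMap.coe_mk, AddHom.coe_mk, Finset.mul_sum]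
  refine Finset.sum_congr rfl fun i _ => ?_
  have h : shift i.1 (shift j v) = shift j (shift i.1 v) := by
    simp only [shift]; abel
  rw [h, hf j, hf j, mul_add]

theorem incidStar_mem_fiber {n : Fin q → ℕ} {d : ℕ} {z : DualGroup n} (f : Cochain n (d + 1))
    (hf : f ∈ fiber n (d + 1) z) : incidStar n d f ∈ fiber n d z := by
  intro j σ v
  simp only [incidStar, LinearMap.coe_mk, AddHom.coe_mk, Finset.mul_sum]
  refine Finset.sum_congr rfl fun i _ => ?_
  have h : shiftInv i.1 (shift j v) = shift j (shiftInv i.1 v) := by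
    simp only [shift, shiftInv]; abel
  rw [h, hf j, hf j, mul_add]

/-- The twisted operator `M_d(z) : C^d_z → C^{d+1}_z`. -/
def twIncid (n : Fin q → ℕ) (d : ℕ) (z : DualGroup n) :
    fiber n d z →ₗ[ℂ] fiber n (d + 1) z :=
  (incid n d).restrict incid_mem_fiber

/-- The twisted operator `M_d^*(z) : C^{d+1}_z → C^d_z`. -/
def twIncidStar (n : Fin q → ℕ) (d : ℕ) (z : DualGroup n) :
    fiber n (d + 1) z →ₗ[ℂ] fiber n d z :=
  (incidStar n d).restrict incidStar_mem_fiber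

/-- The twisted up-adjacency operator `A^{up}_d(z) = M_d^*(z) M_d(z)` on `C^d_z`. -/
def upAdj (n : Fin q → ℕ) (d : ℕ) (z : DualGroup n) : fiber n d z →ₗ[ℂ] fiber n d z :=
  twIncidStar n d z ∘ₗ twIncid n d z

/-- The twisted down-adjacency operator `A^{down}_d(z) = M_{d-1}(z) M_{d-1}^*(z)` on `C^d_z`
(zero for `d = 0`, where there is no `M_{d-1}`). -/
def downAdj (n : Fin q → ℕ) : (d : ℕ) → (z : DualGroup n) → fiber n d z →ₗ[ℂ] fiber n d z
  | 0, _ => 0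
  | d + 1, z => twIncid n d z ∘ₗ twIncidStar n d z

/-! ### Facts that tie the explicit formulas to the notions behind them -/

/-- The inner product of `C^d(Y)`. -/
noncomputable def cochainInner (n : Fin q → ℕ) [∀ i, NeZero (n i)] (d : ℕ)
    (f g : Cochain n d) : ℂ :=
  (Fintype.card (Torus n) : ℂ)⁻¹ *
    ∑ σ : Cell q d, ∑ v : Torus n, f (σ, v) * (starRingEnd ℂ) (g (σ, v))

/-- `M_d^*` is the dual of `M_d`. -/
theorem incid_dual (n : Fin q → ℕ) [∀ i, NeZero (n i)] (d : ℕ) (f : Cochain n d)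
    (g : Cochain n (d + 1)) :
    cochainInner n (d + 1) (incid n d f) g = cochainInner n d f (incidStar n d g) := by
  have key : ∀ F : Cell q (d + 1) → Cell q d → Fin q → ℂ,
      ∑ η : Cell q (d + 1), ∑ j : {j : Fin q // j ∈ η.1}, F η (η.del j) j.1
        = ∑ σ : Cell q d, ∑ j : {j : Fin q // j ∉ σ.1}, F (σ.add j) σ j.1 := by
    intro F
    rw [← Fintype.sum_sigma', ← Fintype.sum_sigma']
    refine Fintype.sum_bijective
      (fun x : (η : Cell q (d + 1)) × {j : Fin q // j ∈ η.1} =>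
        (⟨x.1.del x.2, ⟨x.2.1, by simp [Cell.del]⟩⟩ : (σ : Cell q d) × {j : Fin q // j ∉ σ.1})) ?_ _ _ ?_
    · refine Function.bijective_iff_has_inverse.2
        ⟨fun y => ⟨y.1.add y.2, ⟨y.2.1, by simp [Cell.add]⟩⟩, ?_, ?_⟩
      · rintro ⟨⟨η, hη⟩, ⟨j, hj⟩⟩
        have hj' : j ∈ η := hj
        have h : insert j (η.erase j) = η := Finset.insert_erase hj'
        simp only [Cell.add, Cell.del]
        congr 1
        · exact Subtype.ext h
        · congr 1
          · funext i; simp only [h]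
          · exact proof_irrel_heq _ _
      · rintro ⟨⟨σ, hσ⟩, ⟨j, hj⟩⟩
        have hj' : j ∉ σ := hj
        have h : (insert j σ).erase j = σ := Finset.erase_insert hj'
        simp only [Cell.add, Cell.del]
        congr 1
        · exact Subtype.ext h
        · congr 1
          · funext i; simp only [h]
          · exact proof_irrel_heq _ _
    · rintro ⟨⟨η, hη⟩, ⟨j, hj⟩⟩
      have hj' : j ∈ η := hj
      have h : insert j (η.erase j) = η := Finset.insert_erase hj'
      simp only [Cell.add, Cell.del, h]
  have sh : ∀ (j : Fin q) (a b : Torus n → ℂ),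
      ∑ v, a (shift j v) * (starRingEnd ℂ) (b v)
        = ∑ v, a v * (starRingEnd ℂ) (b (shiftInv j v)) := by
    intro j a b
    refine Fintype.sum_equiv (Equiv.addRight (Pi.single j 1)) _ _ fun v => ?_
    simp [shift, shiftInv]
  have e1 : ∀ η : Cell q (d + 1), ∑ v : Torus n,
      (incid n d f) (η, v) * (starRingEnd ℂ) (g (η, v))
        = ∑ j : {j : Fin q // j ∈ η.1}, ∑ v : Torus n, f (η.del j, v) *
          (starRingEnd ℂ) (g (η, v) + g (η, shiftInv j.1 v)) := by
    intro η
    simp only [incid, LinearMap.coe_mk, AddHom.coe_mk, Finset.sum_mul]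
    change ∑ v : Torus n, ∑ j : {j : Fin q // j ∈ η.1},
      (f (η.del j, v) + f (η.del j, shift j.1 v)) * (starRingEnd ℂ) (g (η, v)) = _
    refine Eq.trans Finset.sum_comm ?_
    refine Finset.sum_congr rfl fun j _ => ?_
    simp only [map_add, mul_add, add_mul, Finset.sum_add_distrib]
    rw [sh j.1 (fun v => f (η.del j, v)) (fun v => g (η, v))]
  have e2 : ∀ σ : Cell q d, ∑ v : Torus n,
      f (σ, v) * (starRingEnd ℂ) ((incidStar n d g) (σ, v))
        = ∑ j : {j : Fin q // j ∉ σ.1}, ∑ v : Torus n, f (σ, v) *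
          (starRingEnd ℂ) (g (σ.add j, v) + g (σ.add j, shiftInv j.1 v)) := by
    intro σ
    simp only [incidStar, LinearMap.coe_mk, AddHom.coe_mk, map_sum, Finset.mul_sum]
    change ∑ v : Torus n, ∑ j : {j : Fin q // j ∉ σ.1},
      f (σ, v) * (starRingEnd ℂ) (g (σ.add j, v) + g (σ.add j, shiftInv j.1 v)) = _
    exact Finset.sum_comm
  simp only [cochainInner, e1, e2]
  congr 1
  exact key fun η σ j => ∑ v : Torus n, f (σ, v) *
    (starRingEnd ℂ) (g (η, v) + g (η, shiftInv j v))

theorem coe_eq_coe_iff {m : ℕ} (x y : ℝ) :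
    (x : AddCircle (m : ℝ)) = (y : AddCircle (m : ℝ)) ↔ ∃ k : ℤ, x = y + k * m := by
  rw [QuotientAddGroup.eq, AddSubgroup.mem_zmultiples_iff]
  constructor
  · rintro ⟨k, hk⟩
    refine ⟨-k, ?_⟩
    rw [zsmul_eq_mul] at hk
    push_cast
    linarith
  · rintro ⟨k, hk⟩
    refine ⟨-k, ?_⟩
    rw [zsmul_eq_mul]
    push_cast
    linarith

theorem zmod_eq_add_iff {m : ℕ} [NeZero m] (v w : ZMod m) (a : ℤ) :
    v = w + a ↔ ∃ k : ℤ, (v.val : ℤ) = w.val + a + k * m := by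
  have h : v = w + a ↔ ((v.val : ℤ) : ZMod m) = ((w.val + a : ℤ) : ZMod m) := by simp
  rw [h, ZMod.intCast_eq_intCast_iff_dvd_sub]
  constructor
  · rintro ⟨k, hk⟩
    exact ⟨-k, by linarith⟩
  · rintro ⟨k, hk⟩
    exact ⟨-k, by linarith⟩

theorem point_subset_point {m : ℕ} [NeZero m] (v w : ZMod m) :
    point m v ⊆ point m w ↔ v = w := by
  have h := zmod_eq_add_iff v w 0
  simp only [Int.cast_zero, add_zero] at h
  rw [point, point, Set.singleton_subset_singleton, coe_eq_coe_iff, h]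
  exact exists_congr fun k => by exact_mod_cast Iff.rfl

theorem point_subset_edge {m : ℕ} [NeZero m] (v w : ZMod m) :
    point m v ⊆ edge m w ↔ v = w ∨ v = w + 1 := by
  have h0 := zmod_eq_add_iff v w 0
  have h1 := zmod_eq_add_iff v w 1
  simp only [Int.cast_zero, add_zero, Int.cast_one] at h0 h1
  rw [point, edge, Set.singleton_subset_iff, h0, h1]
  constructor
  · rintro ⟨t, ⟨ht0, ht1⟩, ht⟩
    obtain ⟨k, hk⟩ := (coe_eq_coe_iff _ _).1 ht
    have a0 : (w.val : ℤ) ≤ v.val + k * m := by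
      have : (w.val : ℝ) ≤ v.val + k * m := by linarith
      exact_mod_cast this
    have a1 : (v.val : ℤ) + k * m ≤ w.val + 1 := by
      have : (v.val : ℝ) + k * m ≤ w.val + 1 := by linarith
      exact_mod_cast this
    rcases (by omega : (v.val : ℤ) + k * m = w.val ∨ (v.val : ℤ) + k * m = w.val + 1) with h | h
    · exact Or.inl ⟨-k, by linarith⟩
    · exact Or.inr ⟨-k, by linarith⟩
  · rintro (⟨k, hk⟩ | ⟨k, hk⟩)
    · refine ⟨w.val, ⟨le_refl _, by linarith⟩, (coe_eq_coe_iff _ _).2 ⟨-k, ?_⟩⟩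
      have : (v.val : ℝ) = w.val + k * m := by exact_mod_cast hk
      push_cast
      linarith
    · refine ⟨w.val + 1, ⟨by linarith, le_refl _⟩, (coe_eq_coe_iff _ _).2 ⟨-k, ?_⟩⟩
      have : (v.val : ℝ) = w.val + 1 + k * m := by exact_mod_cast hk
      push_cast
      linarith

theorem mid_mem_edge (m : ℕ) (v : ZMod m) :
    (((v.val + 1 / 2 : ℝ)) : AddCircle (m : ℝ)) ∈ edge m v :=
  ⟨v.val + 1 / 2, ⟨by linarith, by linarith⟩, rfl⟩

theorem not_edge_subset_point {m : ℕ} (v w : ZMod m) : ¬ edge m v ⊆ point m w := by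
  intro h
  obtain ⟨k, hk⟩ := (coe_eq_coe_iff _ _).1 (Set.mem_singleton_iff.1 (h (mid_mem_edge m v)))
  have : (2 * v.val + 1 : ℤ) = 2 * (w.val + k * m) := by
    have : (2 * v.val + 1 : ℝ) = 2 * (w.val + k * m) := by linarith
    exact_mod_cast this
  omega

theorem edge_subset_edge {m : ℕ} [NeZero m] (v w : ZMod m) :
    edge m v ⊆ edge m w ↔ v = w := by
  refine ⟨fun h => ?_, fun h => h ▸ subset_rfl⟩
  have h0 := zmod_eq_add_iff v w 0
  simp only [Int.cast_zero, add_zero] at h0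
  obtain ⟨t, ⟨ht0, ht1⟩, ht⟩ := h (mid_mem_edge m v)
  obtain ⟨k, hk⟩ := (coe_eq_coe_iff _ _).1 ht
  have a0 : 2 * (w.val : ℤ) ≤ 2 * (v.val + k * m) + 1 := by
    have : 2 * (w.val : ℝ) ≤ 2 * (v.val + k * m) + 1 := by linarith
    exact_mod_cast this
  have a1 : 2 * ((v.val : ℤ) + k * m) + 1 ≤ 2 * (w.val + 1) := by
    have : 2 * ((v.val : ℝ) + k * m) + 1 ≤ 2 * (w.val + 1) := by linarith
    exact_mod_cast this
  exact h0.2 ⟨-k, by linarith [(by omega : (v.val : ℤ) + k * m = w.val)]⟩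

/-- Containment of cubes in the torus, read off from the pairs `(σ, v)`. -/
theorem carrier_subset_iff {n : Fin q → ℕ} [∀ i, NeZero (n i)] {d e : ℕ} (a : Cube n d)
    (b : Cube n e) :
    carrier a ⊆ carrier b ↔ a.1.1 ⊆ b.1.1 ∧ ∀ i,
      a.2 i = b.2 i ∨ (i ∉ a.1.1 ∧ i ∈ b.1.1 ∧ a.2 i = b.2 i + 1) := by
  have hne : ∀ i, (if i ∈ a.1.1 then edge (n i) (a.2 i) else point (n i) (a.2 i)).Nonempty := by
    intro i
    split_ifs
    · exact ⟨_, mid_mem_edge _ _⟩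
    · exact Set.singleton_nonempty _
  have h : carrier a ⊆ carrier b ↔ ∀ i,
      (if i ∈ a.1.1 then edge (n i) (a.2 i) else point (n i) (a.2 i)) ⊆
        (if i ∈ b.1.1 then edge (n i) (b.2 i) else point (n i) (b.2 i)) := by
    rw [carrier, carrier, Set.pi_subset_pi_iff]
    refine ⟨fun h i => ?_, fun h => Or.inl fun i _ => h i⟩
    rcases h with h | h
    · exact h i (Set.mem_univ i)
    · exact absurd h (Set.univ_pi_nonempty_iff.2 hne).ne_empty
  rw [h, Finset.subset_iff, ← forall_and]
  refine forall_congr' fun i => ?_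
  by_cases ha : i ∈ a.1.1 <;> by_cases hb : i ∈ b.1.1 <;>
    simp only [ha, hb, if_true, if_false, edge_subset_edge, point_subset_edge,
      point_subset_point, not_edge_subset_point] <;> simp

end CubicalLattice

open CubicalLattice

/-! ### Determinants and traces of powers -/

namespace Matrix

open Polynomial

variable {ι K : Type*} [Fintype ι] [DecidableEq ι] [Field K] [IsAlgClosed K]

/-! A closed geodesic is a closed walk without backtracking in the bipartite graph on `(d-1)`-cubes
and `d`-cubes, with containment as incidence. Its states are the flags (τ, σ) with τ ⊂ σ, and
`GeodesicStep` is the transition relation, with 0/1 matrix T. Unrolled, closed geodesics are the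
periodic points of the shift on bi-infinite geodesics, and prime cycles are the shift orbits of such
points.

The number of points of period m is tr T^m. Sorting periodic points by orbit turns ∑ tr(T^m) u^m / m
into -∑ log(1 - u^|p|) over prime cycles p, while eigenvalues turn it into -log det(1 - uT). Hence
1/zeta = det(1 - uT) for small u (`exists_zeta_inv_eq_det`).

The graph is biregular: a `d`-cube has 2d = β + 1 faces and a `(d-1)`-cube has 2(q - d + 1) = α + 1
cofaces. With L and K the projections of flags to `d`-cubes and `(d-1)`-cubes, T = (LᵀL - 1)(KᵀK -
1), LLᵀ = β + 1, KKᵀ = α + 1, and M = LKᵀ is the incidence matrix. Sylvester's identity and a Schur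
complement reduce det(1 - uT) to a determinant in MᵀM (`Matrix.det_one_sub_smul_mul_sub_one`), which
is the Ihara–Bass formula; Sylvester's identity again exchanges MᵀM and MMᵀ.

Finally M and Mᵀ commute with translations, so the determinants split over the characters of V
(`isInternal_fiber`). -/

theorem det_aeval_eq_prod_roots_charpoly (A : Matrix ι ι K) (p : K[X]) :
    (aeval A p).det = (A.charpoly.roots.map fun x => p.eval x).prod := by
  -- Both sides are multiplicative in `p`, so over an algebraically closed field it suffices to
  -- compare them on constants and on linear factors.
  let φ : K[X] →* K := (detMonoidHom (n := ι) (R := K)).comp (aeval A : K[X] →ₐ[K] _)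
  let ψ : K[X] →* K :=
    { toFun := fun p => (A.charpoly.roots.map fun x => p.eval x).prod
      map_one' := by simp
      map_mul' := fun p q => by simp }
  have hcard : A.charpoly.roots.card = Fintype.card ι := by
    rw [← Matrix.charpoly_natDegree_eq_dim A]
    exact (splits_iff_card_roots.1 (IsAlgClosed.splits _))
  have hC : ∀ c : K, φ (C c) = ψ (C c) := by
    intro c
    change (aeval A (C c)).det = (A.charpoly.roots.map fun x => (C c).eval x).prod
    rw [aeval_C, Matrix.algebraMap_eq_diagonal, Matrix.det_diagonal]
    simp [hcard]
  have hX : ∀ a : K, φ (X - C a) = ψ (X - C a) := by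
    intro a
    change (aeval A (X - C a)).det = (A.charpoly.roots.map fun x => (X - C a).eval x).prod
    have h1 : A.charpoly.eval a = (A.charpoly.roots.map fun x => a - x).prod := by
      conv_lhs => rw [(IsAlgClosed.splits A.charpoly).eq_prod_roots_of_monic A.charpoly_monic]
      rw [eval_multiset_prod, Multiset.map_map]
      simp
    have h2 : (A.charpoly.roots.map fun x => x - a).prod
        = (-1) ^ Fintype.card ι * (A.charpoly.roots.map fun x => a - x).prod := by
      rw [← hcard, ← Multiset.card_map (fun x => a - x), ← Multiset.prod_map_neg, Multiset.map_map]
      simp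
    simp only [eval_sub, eval_X, eval_C]
    rw [h2, ← h1, Matrix.eval_charpoly, ← Matrix.det_neg]
    congr 1
    simp [Matrix.algebraMap_eq_diagonal, Matrix.scalar_apply]
  change φ p = ψ p
  rw [(IsAlgClosed.splits p).eq_prod_roots, map_mul, map_mul, hC, map_multiset_prod,
    map_multiset_prod, Multiset.map_map, Multiset.map_map]
  congr 2
  exact Multiset.map_congr rfl fun a _ => hX a

/-- Evaluation at `c` is the determinant of `p(A)` for `p = c - X ^ m`. -/
theorem charpoly_pow_eq_prod (A : Matrix ι ι K) (m : ℕ) :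
    (A ^ m).charpoly = (A.charpoly.roots.map fun x => X - C (x ^ m)).prod := by
  refine Polynomial.funext fun c => ?_
  have h := det_aeval_eq_prod_roots_charpoly A (C c - X ^ m)
  rw [Matrix.eval_charpoly, eval_multiset_prod, Multiset.map_map]
  simpa [Matrix.algebraMap_eq_diagonal, Matrix.scalar_apply, Function.comp_def, Pi.algebraMap_def] using h

theorem trace_pow_eq_sum_roots_charpoly (A : Matrix ι ι K) (m : ℕ) :
    (A ^ m).trace = (A.charpoly.roots.map fun x => x ^ m).sum := by
  have h : (A ^ m).charpoly = ((A.charpoly.roots.map (· ^ m)).map fun x => X - C x).prod := by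
    rw [charpoly_pow_eq_prod, Multiset.map_map]; rfl
  rw [trace_eq_sum_roots_charpoly, h, roots_multiset_prod_X_sub_C]

theorem det_one_sub_smul_eq_prod_roots_charpoly (A : Matrix ι ι K) (u : K) :
    (1 - u • A).det = (A.charpoly.roots.map fun x => 1 - u * x).prod := by
  have h := det_aeval_eq_prod_roots_charpoly A (1 - C u * X)
  simpa [Algebra.smul_def] using h

end Matrix

theorem Multiset.hasSum_map_sum {ι α : Type*} (s : Multiset α) {f : ι → α → ℂ} {g : α → ℂ}
    (h : ∀ a ∈ s, HasSum (fun i => f i a) (g a)) :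
    HasSum (fun i => (s.map (f i)).sum) (s.map g).sum := by
  induction s using Multiset.induction_on with
  | empty => simp [hasSum_zero]
  | cons a s ih =>
    simp only [Multiset.map_cons, Multiset.sum_cons]
    exact (h a (by simp)).add (ih fun b hb => h b (by simp [hb]))

namespace Matrix

variable {ι : Type*} [Fintype ι] [DecidableEq ι]

/-- The expansion `det (1 - u A) = exp (- ∑ tr (A ^ m) u ^ m / m)`. -/
theorem exists_hasSum_trace_pow (A : Matrix ι ι ℂ) :
    ∃ r : ℝ, 0 < r ∧ ∀ u : ℂ, ‖u‖ < r → ∃ s : ℂ,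
      HasSum (fun m : ℕ => (A ^ (m + 1)).trace * u ^ (m + 1) / (m + 1)) s ∧
      Complex.exp (-s) = (1 - u • A).det := by
  obtain ⟨R, hR0, hR⟩ : ∃ R : ℝ, 0 < R ∧ ∀ x ∈ A.charpoly.roots, ‖x‖ ≤ R := by
    have hb := (A.charpoly.roots.toFinset.finite_toSet.image norm).bddAbove
    obtain ⟨R, hR⟩ := hb
    -- The maximum with 1 keeps the bound positive even if every eigenvalue is zero.
    refine ⟨max R 1, by positivity, fun x hx => le_max_of_le_left (hR ⟨x, ?_, rfl⟩)⟩
    simpa using hx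
  refine ⟨R⁻¹, by positivity, fun u hu => ?_⟩
  have hlt : ∀ x ∈ A.charpoly.roots, ‖u * x‖ < 1 := by
    intro x hx
    rw [norm_mul]
    calc ‖u‖ * ‖x‖ ≤ ‖u‖ * R := by gcongr; exact hR x hx
      _ < R⁻¹ * R := by gcongr
      _ = 1 := inv_mul_cancel₀ hR0.ne'
  -- Each eigenvalue contributes its own logarithmic series, convergent because `‖u * x‖ < 1`.
  refine ⟨(A.charpoly.roots.map fun x => -Complex.log (1 - u * x)).sum, ?_, ?_⟩
  · have h := Multiset.hasSum_map_sum A.charpoly.roots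
      (f := fun (m : ℕ) x => (u * x) ^ (m + 1) / (m + 1))
      fun x hx => Complex.hasSum_taylorSeries_neg_log' (hlt x hx)
    refine h.congr_fun fun m => ?_
    rw [trace_pow_eq_sum_roots_charpoly, ← Multiset.sum_map_mul_right, ← Multiset.sum_map_div]
    congr 1
    exact Multiset.map_congr rfl fun x _ => by rw [mul_pow]; ring
  · rw [det_one_sub_smul_eq_prod_roots_charpoly, ← Multiset.sum_map_neg', Complex.exp_multiset_sum]
    simp only [Multiset.map_map]
    congr 1
    refine Multiset.map_congr rfl fun x hx => ?_
    simp only [Function.comp_apply, neg_neg]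
    refine Complex.exp_log fun h => ?_
    have := hlt x hx
    rw [← sub_eq_zero.1 h] at this
    simp at this

end Matrix

/-! ### Periodic points and cycles of a permutation -/

namespace Equiv.Perm

open Function

variable {X Q : Type*} (S : Equiv.Perm X)

/-- A periodic point together with a positive multiple of its minimal period amounts to a positive
period together with a point of that period. -/
noncomputable def periodicPtsProdEquiv :
    periodicPts S × ℕ ≃ (m : ℕ) × {x : X // IsPeriodicPt S (m + 1) x} :=
  Equiv.ofBijective
    -- The index is the period minus one on the right, and the multiple minus one on the left.
    (fun p => ⟨minimalPeriod S p.1.1 * (p.2 + 1) - 1, p.1.1, by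
      have h := minimalPeriod_pos_of_mem_periodicPts p.1.2
      have h' : 0 < minimalPeriod S p.1.1 * (p.2 + 1) := by positivity
      rw [Nat.sub_add_cancel h']
      exact (isPeriodicPt_minimalPeriod S p.1.1).mul_const _⟩) <| by
    constructor
    · rintro ⟨⟨x, hx⟩, k⟩ ⟨⟨y, hy⟩, l⟩ h
      obtain ⟨h1, h2⟩ := (Sigma.subtype_ext_iff).1 h
      obtain rfl : x = y := h2
      have hpos := minimalPeriod_pos_of_mem_periodicPts hx
      have ha : 0 < minimalPeriod S x * (k + 1) := by positivity
      have hb : 0 < minimalPeriod S x * (l + 1) := by positivity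
      have h3 : minimalPeriod S x * (k + 1) = minimalPeriod S x * (l + 1) := by
        change minimalPeriod S x * (k + 1) - 1 = minimalPeriod S x * (l + 1) - 1 at h1
        omega
      have h4 := Nat.eq_of_mul_eq_mul_left hpos h3
      obtain rfl : k = l := by omega
      rfl
    · rintro ⟨m, x, hx⟩
      obtain ⟨k, hk⟩ := hx.minimalPeriod_dvd
      obtain ⟨k, rfl⟩ : ∃ l, k = l + 1 := Nat.exists_eq_succ_of_ne_zero (by
        rintro rfl
        simp at hk)
      exact ⟨⟨⟨x, mk_mem_periodicPts m.succ_pos hx⟩, k⟩, Sigma.subtype_ext (by simp [← hk]) rfl⟩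

theorem periodicPtsProdEquiv_fst (p : periodicPts S × ℕ) :
    (periodicPtsProdEquiv S p).1 + 1 = minimalPeriod S p.1.1 * (p.2 + 1) := by
  have h := minimalPeriod_pos_of_mem_periodicPts p.1.2
  have h' : 0 < minimalPeriod S p.1.1 * (p.2 + 1) := by positivity
  exact Nat.sub_add_cancel h'

/-- Powers of `S` commute, so a power of `S` fixing `x` also fixes every `S ^ i x`. -/
theorem SameCycle.mem_periodicPts_right {S : Equiv.Perm X} {x y : X} (h : S.SameCycle x y)
    (hx : x ∈ periodicPts S) : y ∈ periodicPts S := by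
  obtain ⟨n, hn, hx⟩ := Function.mem_periodicPts.1 hx
  obtain ⟨i, rfl⟩ := h
  refine mk_mem_periodicPts hn ?_
  have h1 : (S ^ n) x = x := by rw [← Equiv.Perm.iterate_eq_pow]; exact hx
  change S^[n] _ = _
  rw [Equiv.Perm.iterate_eq_pow, ← Equiv.Perm.mul_apply, (Commute.self_pow S n).symm.zpow_right i |>.eq,
    Equiv.Perm.mul_apply, h1]

/-- The points of the cycle of a periodic point are counted by its minimal period. -/
theorem nonempty_fiber_equiv_zmod (π : periodicPts S → Q)
    (hπ : ∀ x y, π x = π y ↔ S.SameCycle x.1 y.1) (x : periodicPts S) :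
    Nonempty ({y // π y = π x} ≃ ZMod (minimalPeriod S x.1)) := by
  refine ⟨Equiv.trans ?_ (MulAction.orbitZPowersEquiv S x.1)⟩
  refine
    { toFun := fun y => ⟨y.1.1, ?_⟩
      invFun := fun y => ⟨⟨y.1, ?_⟩, ?_⟩
      left_inv := fun _ => rfl
      right_inv := fun _ => rfl }
  · obtain ⟨i, hi⟩ := (hπ _ _).1 y.2.symm
    exact ⟨⟨S ^ i, i, rfl⟩, hi⟩
  · obtain ⟨⟨_, i, rfl⟩, hi⟩ := y.2
    exact SameCycle.mem_periodicPts_right ⟨i, hi⟩ x.2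
  · obtain ⟨⟨_, i, rfl⟩, hi⟩ := y.2
    exact ((hπ _ _).2 ⟨i, hi⟩).symm

/-- The logarithm of the Artin–Mazur zeta function as a sum over cycles. -/
theorem hasSum_neg_log_one_sub_pow (hfin : ∀ m : ℕ, Finite {x : X // IsPeriodicPt S (m + 1) x})
    (π : periodicPts S → Q) (hsurj : Surjective π)
    (hπ : ∀ x y, π x = π y ↔ S.SameCycle x.1 y.1) (len : Q → ℕ)
    (hlen : ∀ x, len (π x) = minimalPeriod S x.1) {u : ℂ} (hu : ‖u‖ < 1) {s : ℂ}
    (hs : HasSum (fun m : ℕ => (Nat.card {x : X // IsPeriodicPt S (m + 1) x} : ℂ) *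
      u ^ (m + 1) / (m + 1)) s)
    (hs' : Summable fun m : ℕ => (Nat.card {x : X // IsPeriodicPt S (m + 1) x} : ℝ) *
      ‖u‖ ^ (m + 1) / (m + 1)) :
    HasSum (fun p : Q => -Complex.log (1 - u ^ len p)) s := by
  have (m : ℕ) : Fintype {x : X // IsPeriodicPt S (m + 1) x} := Fintype.ofFinite _
  -- One term for each pair of a period and a point of that period. The family is absolutely
  -- summable by `hs'`, so it may be regrouped: by period it gives `s`, by point and then by cycle
  -- the logarithms.
  let g : (m : ℕ) × {x : X // IsPeriodicPt S (m + 1) x} → ℂ :=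
    fun a => u ^ (a.1 + 1) / ((a.1 + 1 : ℕ) : ℂ)
  have hg : HasSum g s := by
    have hsum : Summable g := by
      refine Summable.of_norm ((summable_sigma_of_nonneg fun _ => norm_nonneg _).2 ⟨?_, ?_⟩)
      · exact fun m => (hasSum_fintype _).summable
      · refine hs'.congr fun m => ?_
        rw [tsum_fintype]
        simp only [g, norm_div, norm_pow, Complex.norm_natCast, Finset.sum_const, Finset.card_univ,
          nsmul_eq_mul, Nat.card_eq_fintype_card]
        push_cast
        ring
    have h1 := hsum.hasSum.sigma fun m => hasSum_fintype fun c => g ⟨m, c⟩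
    have h2 : HasSum (fun m : ℕ => ∑ c : {x : X // IsPeriodicPt S (m + 1) x}, g ⟨m, c⟩) s := by
      refine hs.congr_fun fun m => ?_
      simp only [g, Finset.sum_const, Finset.card_univ, nsmul_eq_mul, Nat.card_eq_fintype_card]
      push_cast
      ring
    rw [← h1.unique h2]
    exact hsum.hasSum
  have hpos : ∀ x : periodicPts S, 0 < minimalPeriod S x.1 :=
    fun x => minimalPeriod_pos_of_mem_periodicPts x.2
  -- A point of minimal period l has the periods lk, k ≥ 1, and ∑ u^(lk) / (lk) = -log(1 - u^l) / l.
  have h3 : HasSum (fun x : periodicPts S =>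
      -Complex.log (1 - u ^ minimalPeriod S x.1) / minimalPeriod S x.1) s := by
    refine ((periodicPtsProdEquiv S).hasSum_iff.2 hg).prod_fiberwise fun x => ?_
    have h := (Complex.hasSum_taylorSeries_neg_log' (z := u ^ minimalPeriod S x.1) (by
      rw [norm_pow]; exact pow_lt_one₀ (norm_nonneg _) hu (hpos x).ne')).div_const
        (minimalPeriod S x.1 : ℂ)
    refine h.congr_fun fun k => ?_
    simp only [Function.comp_apply, g, periodicPtsProdEquiv_fst]
    rw [pow_mul, div_div, mul_comm ((k : ℂ) + 1)]
    push_cast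
    rfl
  refine ((Equiv.sigmaFiberEquiv π).hasSum_iff.2 h3).sigma fun p => ?_
  obtain ⟨x, rfl⟩ := hsurj p
  obtain ⟨e⟩ := nonempty_fiber_equiv_zmod S π hπ x
  have : NeZero (minimalPeriod S x.1) := ⟨(hpos x).ne'⟩
  have : Fintype {y // π y = π x} := Fintype.ofEquiv _ e.symm
  have hcard : Fintype.card {y // π y = π x} = minimalPeriod S x.1 := by
    rw [Fintype.card_congr e, ZMod.card]
  have h4 : ∀ y : {y // π y = π x}, minimalPeriod S y.1.1 = minimalPeriod S x.1 :=
    fun y => by rw [← hlen, ← hlen, y.2]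
  -- The l points of the cycle contribute equally, which cancels the denominator l.
  have h5 : -Complex.log (1 - u ^ len (π x)) = ∑ y : {y // π y = π x},
      -Complex.log (1 - u ^ minimalPeriod S y.1.1) / minimalPeriod S y.1.1 := by
    simp only [h4, Finset.sum_const, Finset.card_univ, hcard, nsmul_eq_mul, hlen]
    rw [mul_div_cancel₀]
    exact_mod_cast (hpos x).ne'
  rw [h5]
  exact hasSum_fintype _

end Equiv.Perm

/-! ### Subshifts of finite type -/

namespace Subshift

open Function

variable {F : Type*} (R : F → F → Prop)

/-- The bi-infinite sequences with consecutive terms related by `R`. -/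
abbrev Seq : Type _ := {x : ℤ → F // ∀ i, R (x i) (x (i + 1))}

/-- The shift on the sequences. -/
def shiftPerm : Equiv.Perm (Seq R) where
  toFun x := ⟨fun i => x.1 (i + 1), fun i => x.2 (i + 1)⟩
  invFun x := ⟨fun i => x.1 (i - 1), fun i => by
    have h := x.2 (i - 1)
    rw [sub_add_cancel] at h
    change R (x.1 (i - 1)) (x.1 (i + 1 - 1))
    rwa [add_sub_cancel_right]⟩
  left_inv x := Subtype.ext (by simp)
  right_inv x := Subtype.ext (by simp)

theorem shiftPerm_pow_apply (k : ℕ) (x : Seq R) (i : ℤ) : ((shiftPerm R ^ k) x).1 i = x.1 (i + k) := by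
  induction k generalizing i with
  | zero => simp
  | succ k ih =>
    rw [pow_succ', Equiv.Perm.mul_apply]
    change ((shiftPerm R ^ k) x).1 (i + 1) = _
    rw [ih]
    push_cast
    ring_nf

theorem shiftPerm_zpow_apply (k : ℤ) (x : Seq R) (i : ℤ) : ((shiftPerm R ^ k) x).1 i = x.1 (i + k) := by
  obtain ⟨k, rfl | rfl⟩ := k.eq_nat_or_neg
  · exact_mod_cast shiftPerm_pow_apply R k x i
  · have h := shiftPerm_pow_apply R k ((shiftPerm R ^ (-(k : ℤ))) x) (i - k)
    rw [← Equiv.Perm.mul_apply, ← zpow_natCast, ← zpow_add, add_neg_cancel, zpow_zero,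
      sub_add_cancel] at h
    exact h.symm

theorem isPeriodicPt_shiftPerm_iff (k : ℕ) (x : Seq R) :
    IsPeriodicPt (shiftPerm R) k x ↔ Function.Periodic x.1 (k : ℤ) := by
  rw [IsPeriodicPt, IsFixedPt, Equiv.Perm.iterate_eq_pow, Subtype.ext_iff, funext_iff]
  exact forall_congr' fun i => by rw [shiftPerm_pow_apply]

theorem sameCycle_shiftPerm_iff (x y : Seq R) :
    (shiftPerm R).SameCycle x y ↔ ∃ k : ℤ, ∀ i, y.1 i = x.1 (i + k) := by
  refine exists_congr fun k => ?_
  rw [Subtype.ext_iff, funext_iff]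
  exact forall_congr' fun i => by rw [shiftPerm_zpow_apply, eq_comm]

/-- The walks of `m` steps from `a` to `b`. -/
abbrev Walk (m : ℕ) (a b : F) : Type _ :=
  {p : Fin (m + 1) → F // p 0 = a ∧ p (Fin.last m) = b ∧ ∀ i : Fin m, R (p i.castSucc) (p i.succ)}

/-- Splitting off the first step of a walk. -/
def walkSuccEquiv (m : ℕ) (a b : F) :
    Walk R (m + 1) a b ≃ (c : {c // R a c}) × Walk R m c.1 b where
  toFun p := ⟨⟨p.1 1, by
    have h := p.2.2.2 0
    rwa [Fin.castSucc_zero, p.2.1] at h⟩,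
    Fin.tail p.1, rfl, p.2.2.1, fun i => p.2.2.2 i.succ⟩
  invFun c := ⟨Fin.cons a c.2.1, rfl, by
      rw [← Fin.succ_last, Fin.cons_succ]; exact c.2.2.2.1, fun i => by
      refine Fin.cases ?_ (fun j => ?_) i
      · have := c.1.2
        rw [Fin.castSucc_zero, Fin.cons_zero, Fin.cons_succ, c.2.2.1]
        exact this
      · rw [← Fin.succ_castSucc, Fin.cons_succ, Fin.cons_succ]
        exact c.2.2.2.2 j⟩
  left_inv p := by
    obtain ⟨p, rfl, -⟩ := p
    exact Subtype.ext (Fin.cons_self_tail p)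
  right_inv c := by
    obtain ⟨⟨c, hc⟩, p, h, hp⟩ := c
    change p 0 = c at h
    subst h
    rfl

theorem apply_emod {x : ℤ → F} {k : ℤ} (h : Function.Periodic x k) (i : ℤ) : x (i % k) = x i := by
  have := h.int_mul (i / k) (i % k)
  rw [← this]
  congr 1
  rw [mul_comm]
  exact_mod_cast Int.emod_add_mul_ediv i k

/-- The closed walks of `m` steps. -/
abbrev ClosedWalk (m : ℕ) : Type _ :=
  {p : Fin (m + 1) → F // p (Fin.last m) = p 0 ∧ ∀ i : Fin m, R (p i.castSucc) (p i.succ)}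

/-- Sorting the closed walks by their starting points. -/
def closedWalkEquiv (m : ℕ) : ClosedWalk R m ≃ (a : F) × Walk R m a a where
  toFun p := ⟨p.1 0, p.1, rfl, p.2⟩
  invFun p := ⟨p.2.1, p.2.2.2.1.trans p.2.2.1.symm, p.2.2.2.2⟩
  left_inv _ := rfl
  right_inv p := by
    obtain ⟨a, p, rfl, hp⟩ := p
    rfl

/-- Periodic sequences are closed walks. -/
noncomputable def periodicEquiv (m : ℕ) :
    {x : Seq R // IsPeriodicPt (shiftPerm R) (m + 1) x} ≃ ClosedWalk R (m + 1) :=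
  Equiv.ofBijective
    (fun x => ⟨fun i => x.1.1 (i : ℕ), by
      have := (isPeriodicPt_shiftPerm_iff R _ _).1 x.2 0
      simpa using this, fun i => by
      have := x.1.2 (i : ℕ)
      simpa using this⟩) <| by
    constructor
    · rintro ⟨x, hx⟩ ⟨y, hy⟩ h
      rw [isPeriodicPt_shiftPerm_iff] at hx hy
      have h2 : ∀ i : Fin (m + 2), x.1 (i : ℕ) = y.1 (i : ℕ) := congrFun (Subtype.ext_iff.1 h)
      refine Subtype.ext (Subtype.ext (funext fun i => ?_))
      rw [← apply_emod hx, ← apply_emod hy]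
      have h0 : 0 ≤ i % ((m + 1 : ℕ) : ℤ) := Int.emod_nonneg _ (by positivity)
      have h1 : i % ((m + 1 : ℕ) : ℤ) < (m + 1 : ℕ) := Int.emod_lt_of_pos _ (by positivity)
      lift i % ((m + 1 : ℕ) : ℤ) to ℕ using h0 with j
      exact h2 ⟨j, by omega⟩
    · rintro ⟨p, hp1, hp⟩
      have h0 : ∀ i, 0 ≤ i % ((m + 1 : ℕ) : ℤ) := fun i => Int.emod_nonneg _ (by positivity)
      have h1 : ∀ i, i % ((m + 1 : ℕ) : ℤ) < (m + 1 : ℕ) :=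
        fun i => Int.emod_lt_of_pos _ (by positivity)
      let x : ℤ → F := fun i => p ⟨(i % ((m + 1 : ℕ) : ℤ)).toNat, by
        have := h0 i; have := h1 i; omega⟩
      have hx : ∀ i : Fin (m + 2), x (i : ℕ) = p i := by
        intro i
        by_cases hi : (i : ℕ) = m + 1
        -- The last index has residue 0, so here the closing condition of the walk is needed.
        · have : i = Fin.last (m + 1) := Fin.ext hi
          subst this
          rw [hp1]
          change p _ = p _
          congr 1
          ext
          simp
        · change p _ = p _
          congr 1
          ext
          have : (i : ℕ) % (m + 1) = i := Nat.mod_eq_of_lt (by omega)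
          change (((i : ℕ) : ℤ) % ((m + 1 : ℕ) : ℤ)).toNat = i
          rw [← Int.natCast_mod, this]
          rfl
      have hper : Function.Periodic x ((m + 1 : ℕ) : ℤ) := by
        intro i
        simp only [x, Int.add_emod_right]
      have hR : ∀ i, R (x i) (x (i + 1)) := by
        intro i
        -- Only `i` is reduced modulo the period, not its successor, so the step out of residue m is
        -- the last step of `p`.
        have e1 : x (i + 1) = x (i % ((m + 1 : ℕ) : ℤ) + 1) := by
          rw [← apply_emod hper (i + 1), ← apply_emod hper (_ + 1), Int.emod_add_emod]
        rw [e1, ← apply_emod hper i]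
        have a0 := h0 i
        have a1 := h1 i
        lift i % ((m + 1 : ℕ) : ℤ) to ℕ using a0 with j
        have := hp ⟨j, by omega⟩
        rw [← hx, ← hx] at this
        simpa using this
      refine ⟨⟨⟨x, hR⟩, (isPeriodicPt_shiftPerm_iff R _ _).2 hper⟩, Subtype.ext (funext hx)⟩

variable [Fintype F] [DecidableEq F] [DecidableRel R]

/-- Splitting off the first step of a walk matches the expansion of the power as matrix times lower
power. -/
theorem card_walk (m : ℕ) (a b : F) :
    ((Matrix.of fun a b => if R a b then (1 : ℂ) else 0) ^ m) a b = Nat.card (Walk R m a b) := by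
  induction m generalizing a with
  | zero =>
    rw [pow_zero, Matrix.one_apply]
    split_ifs with h
    · subst h
      have : Unique (Walk R 0 a a) :=
        { default := ⟨fun _ => a, rfl, rfl, fun i => i.elim0⟩
          uniq := fun p => Subtype.ext (funext fun i => by
            obtain rfl : i = 0 := Fin.fin_one_eq_zero i
            exact p.2.1) }
      simp
    · have : IsEmpty (Walk R 0 a b) := ⟨fun p => h (p.2.1.symm.trans p.2.2.1)⟩
      simp
  | succ m ih =>
    have (c : F) : Finite (Walk R m c b) := Subtype.finite
    rw [pow_succ', Matrix.mul_apply, Nat.card_congr (walkSuccEquiv R m a b), Nat.card_sigma]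
    simp only [ih, Matrix.of_apply, ite_mul, one_mul, zero_mul]
    rw [← Finset.sum_filter, Nat.cast_sum]
    exact (Finset.sum_subtype _ (by simp) _)

theorem card_isPeriodicPt_shiftPerm (m : ℕ) :
    ((Matrix.of fun a b => if R a b then (1 : ℂ) else 0) ^ (m + 1)).trace
      = Nat.card {x : Seq R // IsPeriodicPt (shiftPerm R) (m + 1) x} := by
  have (c : F) : Finite (Walk R (m + 1) c c) := Subtype.finite
  rw [Nat.card_congr ((periodicEquiv R m).trans (closedWalkEquiv R (m + 1))), Nat.card_sigma, Matrix.trace]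
  simp [card_walk]

end Subshift

/-! ### The Ihara–Bass formula for biregular bipartite graphs -/

namespace Matrix

variable {A B F : Type*} [Fintype A] [Fintype B] [Fintype F] [DecidableEq A] [DecidableEq B]
  [DecidableEq F]

/-- Sylvester's identity with the scalar `c` factored out of both determinants. -/
theorem det_smul_one_add_smul_mul (U : Matrix F A ℂ) (W : Matrix A F ℂ) {c : ℂ} (hc : c ≠ 0)
    (u : ℂ) :
    (c • (1 : Matrix F F ℂ) + u • (U * W)).det =
      c ^ Fintype.card F * (c ^ Fintype.card A)⁻¹ * (c • (1 : Matrix A A ℂ) + u • (W * U)).det := by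
  have h1 : c • (1 : Matrix F F ℂ) + u • (U * W) = c • (1 + (c⁻¹ * u) • U * W) := by
    rw [smul_add, Matrix.smul_mul, smul_smul, mul_inv_cancel_left₀ hc]
  have h2 : c • (1 : Matrix A A ℂ) + u • (W * U) = c • (1 + W * (c⁻¹ * u) • U) := by
    rw [smul_add, Matrix.mul_smul, smul_smul, mul_inv_cancel_left₀ hc]
  rw [h1, h2, det_smul, det_smul, det_one_add_mul_comm]
  field_simp

theorem det_smul_one_sub_smul_mul_comm (U : Matrix F A ℂ) (W : Matrix A F ℂ) {c : ℂ} (hc : c ≠ 0)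
    (u : ℂ) :
    (c • (1 : Matrix F F ℂ) - u • (U * W)).det =
      c ^ Fintype.card F * (c ^ Fintype.card A)⁻¹ * (c • (1 : Matrix A A ℂ) - u • (W * U)).det := by
  have h := det_smul_one_add_smul_mul U W hc (-u)
  simpa only [neg_smul, ← sub_eq_add_neg] using h

/-- The matrix on the left is a scalar plus a product factoring through `B ⊕ A`. Sylvester's
identity moves the determinant there, and eliminating the scalar `B`-block leaves a determinant on
`A`. -/
theorem det_one_sub_smul_mul_sub_one (L : Matrix B F ℂ) (K : Matrix A F ℂ) {α β : ℂ}
    (hL : L * Lᵀ = (β + 1) • 1) (hK : K * Kᵀ = (α + 1) • 1) {u : ℂ} (hu : 1 - u ≠ 0)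
    (hβ : 1 + β * u ≠ 0) :
    (1 - u • ((Lᵀ * L - 1) * (Kᵀ * K - 1))).det =
      (1 - u) ^ Fintype.card F * ((1 - u) ^ (Fintype.card A + Fintype.card B))⁻¹ *
        ((1 + β * u) ^ Fintype.card B * ((1 + β * u) ^ Fintype.card A)⁻¹) *
        (((1 + α * u) * (1 + β * u)) • (1 : Matrix A A ℂ) -
          u • ((L * Kᵀ)ᵀ * (L * Kᵀ))).det := by
  set M := L * Kᵀ with hM
  have hM' : K * Lᵀ = Mᵀ := by rw [hM, transpose_mul, transpose_transpose]
  have h1 : 1 - u • ((Lᵀ * L - 1) * (Kᵀ * K - 1)) = (1 - u) • (1 : Matrix F F ℂ) +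
      u • (fromCols Lᵀ (Kᵀ - Lᵀ * M) * fromRows L K) := by
    rw [fromCols_mul_fromRows, Matrix.sub_mul (Kᵀ), Matrix.mul_assoc Lᵀ M K, hM]
    simp only [Matrix.sub_mul, Matrix.mul_sub, Matrix.mul_one, Matrix.one_mul, Matrix.mul_assoc]
    module
  have h2 : (1 - u) • (1 : Matrix (B ⊕ A) (B ⊕ A) ℂ) +
      u • (fromRows L K * fromCols Lᵀ (Kᵀ - Lᵀ * M)) =
      fromBlocks ((1 + β * u) • 1) (-(u * β) • M) (u • Mᵀ)
        ((1 + α * u) • 1 - u • (Mᵀ * M)) := by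
    rw [fromRows_mul_fromCols, ← fromBlocks_one, fromBlocks_smul, fromBlocks_smul, fromBlocks_add,
      Matrix.mul_sub, Matrix.mul_sub, ← Matrix.mul_assoc L, ← Matrix.mul_assoc K Lᵀ, hL, hK, hM',
      ← hM, Matrix.smul_mul, Matrix.one_mul]
    congr 1
    · module
    · module
    · module
    · module
  let _ : Invertible ((1 + β * u) • (1 : Matrix B B ℂ)) :=
    ⟨(1 + β * u)⁻¹ • 1, by simp [smul_smul, hβ], by simp [smul_smul, hβ]⟩
  have hinv : ⅟((1 + β * u) • (1 : Matrix B B ℂ)) = (1 + β * u)⁻¹ • 1 := rfl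
  have hβ' : 1 + u * β ≠ 0 := by rwa [mul_comm]
  -- The Schur complement: its two `MᵀM` terms have total coefficient -u + βu²/(1 + βu) = -u/(1 +
  -- βu).
  have h3 : ((1 + α * u) • (1 : Matrix A A ℂ) - u • (Mᵀ * M) -
      (u • Mᵀ) * ((1 + β * u)⁻¹ • (1 : Matrix B B ℂ)) * (-(u * β) • M)) =
      (1 + β * u)⁻¹ • (((1 + α * u) * (1 + β * u)) • (1 : Matrix A A ℂ) - u • (Mᵀ * M)) := by
    simp only [Matrix.smul_mul, Matrix.mul_smul, Matrix.mul_one, smul_smul, smul_sub]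
    match_scalars
    · field_simp
    · field_simp
      ring
  rw [h1, det_smul_one_add_smul_mul _ _ hu, h2, det_fromBlocks₁₁, hinv, h3, det_smul, det_smul,
    det_one, Fintype.card_sum, inv_pow, add_comm (Fintype.card B)]
  ring

end Matrix

section Biregular

open scoped Matrix

variable {A B : Type*} [Fintype A] [Fintype B] [DecidableEq A] [DecidableEq B]
  (I : A → B → Prop) [DecidableRel I]

/-- The incident pairs of a relation. -/
abbrev IncidentPair : Type _ := {p : A × B // I p.1 p.2}

/-- One step of a geodesic in the bipartite incidence graph, from a flag to a flag. -/
abbrev GeodesicStep (f g : IncidentPair I) : Prop := I g.1.1 f.1.2 ∧ f.1.1 ≠ g.1.1 ∧ f.1.2 ≠ g.1.2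

/-- The matrix of the projection of flags to their first members. -/
def fstMatrix : Matrix A (IncidentPair I) ℂ := Matrix.of fun a f => if f.1.1 = a then 1 else 0

/-- The matrix of the projection of flags to their second members. -/
def sndMatrix : Matrix B (IncidentPair I) ℂ := Matrix.of fun b f => if f.1.2 = b then 1 else 0

/-- The incidence matrix. -/
def incMatrix : Matrix B A ℂ := Matrix.of fun b a => if I a b then 1 else 0

/-- A step from (a, b) to (a', b') passes through the single intermediate flag (a', b): first a
changes with b fixed, then b changes with a' fixed. Each factor is the 0/1 matrix of one such
half-step. -/
theorem geodesicStep_matrix_eq :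
    (Matrix.of fun f g : IncidentPair I => if GeodesicStep I f g then (1 : ℂ) else 0) =
      ((sndMatrix I)ᵀ *
        sndMatrix I - 1) *
      ((fstMatrix I)ᵀ *
        fstMatrix I - 1) := by
  have hP : ∀ f g : IncidentPair I,
      ((sndMatrix I)ᵀ * sndMatrix I - 1 : Matrix (IncidentPair I) (IncidentPair I) ℂ) f g =
      if f.1.2 = g.1.2 ∧ f.1.1 ≠ g.1.1 then 1 else 0 := by
    intro f g
    simp only [Matrix.sub_apply, Matrix.mul_apply, Matrix.transpose_apply, Matrix.of_apply, sndMatrix,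
      Matrix.one_apply, ite_mul, one_mul, zero_mul, Finset.sum_ite_eq, Finset.mem_univ, if_true,
      Subtype.ext_iff, Prod.ext_iff]
    by_cases h1 : f.1.2 = g.1.2 <;> by_cases h2 : f.1.1 = g.1.1 <;> simp [h1, h2, eq_comm]
  have hQ : ∀ f g : IncidentPair I,
      ((fstMatrix I)ᵀ * fstMatrix I - 1 : Matrix (IncidentPair I) (IncidentPair I) ℂ) f g =
      if f.1.1 = g.1.1 ∧ f.1.2 ≠ g.1.2 then 1 else 0 := by
    intro f g
    simp only [Matrix.sub_apply, Matrix.mul_apply, Matrix.transpose_apply, Matrix.of_apply, fstMatrix,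
      Matrix.one_apply, ite_mul, one_mul, zero_mul, Finset.sum_ite_eq, Finset.mem_univ, if_true,
      Subtype.ext_iff, Prod.ext_iff]
    by_cases h1 : f.1.2 = g.1.2 <;> by_cases h2 : f.1.1 = g.1.1 <;> simp [h1, h2, eq_comm]
  ext f g
  rw [Matrix.mul_apply]
  simp only [hP, hQ, Matrix.of_apply, GeodesicStep, ← ite_and, mul_ite, mul_one, mul_zero]
  by_cases h : I g.1.1 f.1.2
  · rw [Finset.sum_eq_single (⟨(g.1.1, f.1.2), h⟩ : IncidentPair I)]
    · simp only [h, true_and, ne_eq, and_comm]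
    · intro k _ hk
      refine if_neg fun hh => hk (Subtype.ext (Prod.ext hh.1.1 hh.2.1.symm))
    · simp
  · rw [Finset.sum_eq_zero, if_neg (fun hh => h hh.1)]
    intro k _
    refine if_neg fun hh => h ?_
    rw [← hh.1.1, hh.2.1]
    exact k.2

/-- The Ihara–Bass formula for a biregular bipartite graph. -/
theorem det_one_sub_smul_geodesicStep {α β : ℂ}
    (hA : ∀ a, (Fintype.card {b // I a b} : ℂ) = α + 1)
    (hB : ∀ b, (Fintype.card {a // I a b} : ℂ) = β + 1) {u : ℂ} (hu : 1 - u ≠ 0)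
    (hβ : 1 + β * u ≠ 0) :
    (1 - u • (Matrix.of fun f g : IncidentPair I => if GeodesicStep I f g then (1 : ℂ) else 0)).det =
      (1 - u) ^ Fintype.card (IncidentPair I) * ((1 - u) ^ (Fintype.card A + Fintype.card B))⁻¹ *
        ((1 + β * u) ^ Fintype.card B * ((1 + β * u) ^ Fintype.card A)⁻¹) *
        (((1 + α * u) * (1 + β * u)) • (1 : Matrix A A ℂ) -
          u • ((incMatrix I)ᵀ * incMatrix I)).det := by
  rw [geodesicStep_matrix_eq, Matrix.det_one_sub_smul_mul_sub_one (α := α) (β := β) _ _ ?_ ?_ hu hβ]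
  · have h : sndMatrix I *
        (fstMatrix I)ᵀ =
          incMatrix I := by
      ext b a
      simp only [Matrix.mul_apply, Matrix.transpose_apply, Matrix.of_apply, fstMatrix, sndMatrix, incMatrix, mul_ite,
        mul_one, mul_zero, ← ite_and]
      by_cases h : I a b
      · rw [Finset.sum_eq_single (⟨(a, b), h⟩ : IncidentPair I)]
        · simp [h]
        · intro k _ hk
          exact if_neg fun hh => hk (Subtype.ext (Prod.ext hh.1 hh.2))
        · simp
      · rw [Finset.sum_eq_zero, if_neg h]
        intro k _
        refine if_neg fun hh => h ?_
        rw [← hh.1, ← hh.2]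
        exact k.2
    rw [h]
  -- Off the diagonal no flag projects to both `b` and `b'`; on it, the flags over `b` are counted
  -- by `hB`.
  · ext b b'
    simp only [Matrix.mul_apply, Matrix.transpose_apply, Matrix.of_apply, sndMatrix, mul_ite,
        mul_one, mul_zero, ← ite_and, Matrix.smul_apply, Matrix.one_apply, smul_eq_mul]
    split_ifs with h
    · subst h
      rw [← hB b, ← Finset.sum_filter, Finset.sum_const, nsmul_eq_mul, mul_one,
        ← Fintype.card_subtype]
      norm_cast
      refine Fintype.card_congr ⟨fun f => ⟨f.1.1.1, by
        have := f.1.2; rwa [f.2.1] at this⟩, fun a => ⟨⟨(a.1, b), a.2⟩, rfl, rfl⟩, ?_, fun _ => rfl⟩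
      rintro ⟨⟨⟨a, b⟩, h⟩, rfl, h'⟩
      rfl
    · exact Finset.sum_eq_zero fun f _ => if_neg fun hh => h (by rw [← hh.1, ← hh.2])
  · ext b b'
    simp only [Matrix.mul_apply, Matrix.transpose_apply, Matrix.of_apply, fstMatrix, mul_ite,
        mul_one, mul_zero, ← ite_and, Matrix.smul_apply, Matrix.one_apply, smul_eq_mul]
    split_ifs with h
    · subst h
      rw [← hA b, ← Finset.sum_filter, Finset.sum_const, nsmul_eq_mul, mul_one,
        ← Fintype.card_subtype]
      norm_cast
      refine Fintype.card_congr ⟨fun f => ⟨f.1.1.2, by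
        have := f.1.2; rwa [f.2.1] at this⟩, fun a => ⟨⟨(b, a.1), a.2⟩, rfl, rfl⟩, ?_, fun _ => rfl⟩
      rintro ⟨⟨⟨a, b⟩, h⟩, rfl, h'⟩
      rfl
    · exact Finset.sum_eq_zero fun f _ => if_neg fun hh => h (by rw [← hh.1, ← hh.2])

end Biregular

/-! ### Prime cycles as cycles of a shift -/

namespace CubicalLattice

open Function Subshift

variable {q : ℕ}

/-- A `d`-cube is incident to a `(d+1)`-cube if it is contained in it. -/
def Incident (n : Fin q → ℕ) (d : ℕ) (a : Cube n d) (b : Cube n (d + 1)) : Prop :=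
  carrier a ⊆ carrier b

/-- The bi-infinite geodesics. -/
abbrev GeodesicSeq (n : Fin q → ℕ) (d : ℕ) : Type := Seq (GeodesicStep (Incident n d))

namespace ClosedPath

variable {n : Fin q → ℕ} {d : ℕ}

theorem incident_self (c : ClosedPath n (d + 1)) (i : ZMod c.length) :
    Incident n d (c.τ i) (c.σ i) := by
  have h := (c.subset (i - 1)).trans Set.inter_subset_right
  rwa [sub_add_cancel] at h

/-- The unrolling of a closed geodesic. -/
def toSeq (c : ClosedPath n (d + 1)) (hc : c.IsGeodesic) : GeodesicSeq n d :=
  ⟨fun i => ⟨(c.τ i, c.σ i), c.incident_self i⟩, fun i => by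
    have h1 := c.ne i
    have h2 := hc i
    have h3 := (c.subset i).trans Set.inter_subset_left
    refine ⟨?_, ?_, ?_⟩
    · push_cast; exact h3
    · push_cast; exact h1
    · push_cast; exact h2⟩

theorem toSeq_periodic (c : ClosedPath n (d + 1)) (hc : c.IsGeodesic) :
    Function.Periodic (c.toSeq hc).1 (c.length : ℤ) := fun i => by
  simp [toSeq]

/-- Rolling up a periodic bi-infinite geodesic. -/
def ofSeq (x : GeodesicSeq n d) (m : ℕ) (hm : 0 < m) (hx : Function.Periodic x.1 (m : ℤ)) :
    ClosedPath n (d + 1) where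
  length := m
  length_pos := hm
  τ i := (x.1 i.cast).1.1
  σ i := (x.1 i.cast).1.2
  ne i := by
    -- The representative of `i + 1` may wrap around to 0; periodicity makes this harmless.
    have h : x.1 (i + 1 : ZMod m).cast = x.1 (i.cast + 1) := by
      rw [← apply_emod hx (i.cast + 1), ← ZMod.coe_intCast]
      simp
    rw [h]
    exact (x.2 i.cast).2.1
  subset i := by
    have h : x.1 (i + 1 : ZMod m).cast = x.1 (i.cast + 1) := by
      rw [← apply_emod hx (i.cast + 1), ← ZMod.coe_intCast]
      simp
    rw [h]
    exact Set.subset_inter (x.2 i.cast).1 (x.1 (i.cast + 1)).2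

variable {x : GeodesicSeq n d} {m : ℕ} {hm : 0 < m} {hx : Function.Periodic x.1 (m : ℤ)}

theorem ofSeq_τ (i : ℤ) : (ofSeq x m hm hx).τ i = (x.1 i).1.1 := by
  change (x.1 ((i : ZMod m).cast)).1.1 = _
  rw [ZMod.coe_intCast, apply_emod hx]

theorem ofSeq_σ (i : ℤ) : (ofSeq x m hm hx).σ i = (x.1 i).1.2 := by
  change (x.1 ((i : ZMod m).cast)).1.2 = _
  rw [ZMod.coe_intCast, apply_emod hx]

theorem ofSeq_isGeodesic : (ofSeq x m hm hx).IsGeodesic := by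
  intro i
  obtain ⟨i, rfl⟩ := ZMod.intCast_surjective i
  have h := (x.2 i).2.2
  rw [← ofSeq_σ (hm := hm) (hx := hx), ← ofSeq_σ (hm := hm) (hx := hx)] at h
  exact_mod_cast h

/-- If the path repeated a shorter one, the length of the shorter one would be a period of `x` below
the minimal period. -/
theorem ofSeq_isPrime (hmin : minimalPeriod (shiftPerm _) x = m) : (ofSeq x m hm hx).IsPrime := by
  refine ⟨ofSeq_isGeodesic, ?_⟩
  rintro ⟨k, c, hk, hc, hl, hmul⟩
  change m = k * c.length at hl
  have hcpos := c.length_pos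
  have hnat : ∀ i : ℕ, x.1 i = (c.toSeq hc).1 i := by
    intro i
    obtain ⟨h1, h2⟩ := hmul i
    have e1 := ofSeq_τ (hm := hm) (hx := hx) i
    have e2 := ofSeq_σ (hm := hm) (hx := hx) i
    rw [Int.cast_natCast] at e1 e2
    refine Subtype.ext (Prod.ext ?_ ?_)
    · exact e1.symm.trans (h1.trans (by simp [toSeq]))
    · exact e2.symm.trans (h2.trans (by simp [toSeq]))
  -- `IsMultiple` compares natural indices only; the known period `m` carries the new period to
  -- negative ones.
  have hper : Function.Periodic x.1 (c.length : ℤ) := by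
    intro i
    rw [← apply_emod hx, ← Int.emod_add_emod, apply_emod hx, ← apply_emod hx i]
    have h0 : 0 ≤ i % (m : ℤ) := Int.emod_nonneg _ (by exact_mod_cast hm.ne')
    lift i % (m : ℤ) to ℕ using h0 with j
    have h := hnat (j + c.length)
    push_cast at h
    rw [h, hnat, c.toSeq_periodic hc]
  have hle := ((isPeriodicPt_shiftPerm_iff _ _ _).2 hper).minimalPeriod_le hcpos
  rw [hmin, hl] at hle
  nlinarith

/-- The minimal period divides the length; a quotient of at least 2 would exhibit `c` as a proper
multiple of the geodesic rolled up at the minimal period. -/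
theorem minimalPeriod_toSeq {c : ClosedPath n (d + 1)} (hc : c.IsPrime) :
    minimalPeriod (shiftPerm _) (c.toSeq hc.1) = c.length := by
  have hp := (isPeriodicPt_shiftPerm_iff _ _ _).2 (c.toSeq_periodic hc.1)
  obtain ⟨k, hk⟩ := hp.minimalPeriod_dvd
  have hpos := hp.minimalPeriod_pos c.length_pos
  have hcpos := c.length_pos
  have h1 : k = 1 := by
    by_contra hne
    have h2 : 2 ≤ k := by
      rcases k with _ | _ | k
      · simp at hk; omega
      · exact absurd rfl hne
      · omega
    refine hc.2 ⟨k, ofSeq (c.toSeq hc.1) _ hpos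
      ((isPeriodicPt_shiftPerm_iff _ _ _).1 (isPeriodicPt_minimalPeriod _ _)), h2, ofSeq_isGeodesic,
      hk.trans (mul_comm _ _), fun i => ?_⟩
    rw [← Int.cast_natCast (R := ZMod (ofSeq _ _ _ _).length), ofSeq_τ, ofSeq_σ]
    simp [toSeq]
  rw [hk, h1, mul_one]

end ClosedPath

variable {n : Fin q → ℕ} {d : ℕ}

theorem minimalPeriod_shiftPerm_eq_of_sameCycle {F : Type*} {R : F → F → Prop} {x y : Seq R}
    (h : (shiftPerm R).SameCycle x y) : minimalPeriod (shiftPerm R) x = minimalPeriod (shiftPerm R) y := by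
  rw [sameCycle_shiftPerm_iff] at h
  obtain ⟨k, hk⟩ := h
  refine minimalPeriod_eq_minimalPeriod_iff.2 fun m => ?_
  rw [isPeriodicPt_shiftPerm_iff, isPeriodicPt_shiftPerm_iff]
  constructor
  · intro h i
    rw [hk, hk, add_right_comm, h]
  · intro h i
    have := h (i - k)
    rwa [hk, hk, add_right_comm, sub_add_cancel] at this

/-- The prime cycle of a periodic bi-infinite geodesic. -/
noncomputable def primeCycleOfPeriodic (x : periodicPts (shiftPerm (GeodesicStep (Incident n d)))) :
    PrimeCycle n (d + 1) :=
  Quotient.mk _ ⟨ClosedPath.ofSeq x.1 _ (minimalPeriod_pos_of_mem_periodicPts x.2)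
    ((isPeriodicPt_shiftPerm_iff _ _ _).1 (isPeriodicPt_minimalPeriod _ _)),
    ClosedPath.ofSeq_isPrime rfl⟩

theorem primeCycleOfPeriodic_length (x : periodicPts (shiftPerm (GeodesicStep (Incident n d)))) :
    (primeCycleOfPeriodic x).length = minimalPeriod (shiftPerm _) x.1 := rfl

/-- Cyclic permutations unroll to powers of the shift. The equality of lengths follows, as minimal
periods are constant on cycles. -/
theorem primeCycleOfPeriodic_eq_iff (x y : periodicPts (shiftPerm (GeodesicStep (Incident n d)))) :
    primeCycleOfPeriodic x = primeCycleOfPeriodic y ↔ (shiftPerm _).SameCycle x.1 y.1 := by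
  refine (Quotient.eq (r := primeSetoid n (d + 1))).trans ?_
  change ClosedPath.IsCyclicPerm _ _ ↔ _
  have key : (∃ k : ℤ, ∀ i : ℤ, y.1.1 i = x.1.1 (i + k)) ↔ ∃ k : ℤ, ∀ i : ℤ,
      (y.1.1 i).1.1 = (x.1.1 (i + k)).1.1 ∧ (y.1.1 i).1.2 = (x.1.1 (i + k)).1.2 := by
    simp only [Subtype.ext_iff, Prod.ext_iff]
  rw [sameCycle_shiftPerm_iff, key, ClosedPath.IsCyclicPerm]
  simp only [ClosedPath.ofSeq_τ, ClosedPath.ofSeq_σ]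
  refine ⟨And.right, fun h => ⟨?_, h⟩⟩
  exact minimalPeriod_shiftPerm_eq_of_sameCycle ((sameCycle_shiftPerm_iff _ _ _).2 (key.2 h))

theorem primeCycleOfPeriodic_surjective :
    Surjective (primeCycleOfPeriodic : _ → PrimeCycle n (d + 1)) := by
  intro p
  induction p using Quotient.inductionOn with
  | h c =>
    obtain ⟨c, hc⟩ := c
    have hp := (isPeriodicPt_shiftPerm_iff _ _ _).2 (c.toSeq_periodic hc.1)
    refine ⟨⟨c.toSeq hc.1, mk_mem_periodicPts c.length_pos hp⟩, Quotient.sound ?_⟩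
    change ClosedPath.IsCyclicPerm _ _
    refine ⟨ClosedPath.minimalPeriod_toSeq hc, 0, fun i => ?_⟩
    rw [ClosedPath.ofSeq_τ, ClosedPath.ofSeq_σ, add_zero]
    exact ⟨rfl, rfl⟩

end CubicalLattice

/-! ### Incidence numbers and incidence operators -/

namespace CubicalLattice

variable {q : ℕ} {n : Fin q → ℕ} {d : ℕ}

theorem shift_apply_self (j : Fin q) (v : Torus n) : shift j v j = v j + 1 := by simp [shift]

theorem shift_apply_of_ne {i j : Fin q} (h : i ≠ j) (v : Torus n) : shift j v i = v i := by
  simp [shift, h]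

theorem shift_shiftInv (j : Fin q) (v : Torus n) : shift j (shiftInv j v) = v := by
  simp [shift, shiftInv]

theorem shiftInv_shift (j : Fin q) (v : Torus n) : shiftInv j (shift j v) = v := by
  simp [shift, shiftInv]

/-- The source of the condition that all side lengths are at least 2: opposite faces are distinct,
so faces and cofaces are listed without repetition and incidence is a 0/1 matrix. -/
theorem shift_ne_self (hn : ∀ i, 2 ≤ n i) (j : Fin q) (v : Torus n) : shift j v ≠ v := by
  intro h
  have h1 := congrFun h j
  rw [shift_apply_self] at h1
  have : Fact (1 < n j) := ⟨hn j⟩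
  exact one_ne_zero (add_eq_left.1 h1)

/-- The faces of a cube, by direction and side. -/
def face (c : Cube n (d + 1)) (p : {j // j ∈ c.1.1} × Bool) : Cube n d :=
  (c.1.del p.1, if p.2 then shift p.1.1 c.2 else c.2)

/-- The cofaces of a cube, by direction and side. -/
def coface (c : Cube n d) (p : {j // j ∉ c.1.1} × Bool) : Cube n (d + 1) :=
  (c.1.add p.1, if p.2 then shiftInv p.1.1 c.2 else c.2)

theorem face_injective (hn : ∀ i, 2 ≤ n i) (c : Cube n (d + 1)) :
    Function.Injective (face c) := by
  rintro ⟨⟨i, hi⟩, a⟩ ⟨⟨j, hj⟩, b⟩ h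
  obtain ⟨h1, h2⟩ := Prod.ext_iff.1 h
  have h3 : c.1.1.erase i = c.1.1.erase j := congrArg Subtype.val h1
  obtain rfl : i = j := by
    by_contra hij
    have : i ∈ c.1.1.erase j := Finset.mem_erase.2 ⟨hij, hi⟩
    rw [← h3] at this
    simp at this
  have h4 := shift_ne_self hn i c.2
  obtain rfl : a = b := by
    cases a <;> cases b <;> first | rfl | exact absurd h2 h4 | exact absurd h2.symm h4
  rfl

theorem coface_injective (hn : ∀ i, 2 ≤ n i) (c : Cube n d) :
    Function.Injective (coface c) := by
  rintro ⟨⟨i, hi⟩, a⟩ ⟨⟨j, hj⟩, b⟩ h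
  obtain ⟨h1, h2⟩ := Prod.ext_iff.1 h
  have h3 : insert i c.1.1 = insert j c.1.1 := congrArg Subtype.val h1
  obtain rfl : i = j := by
    have : i ∈ insert j c.1.1 := h3 ▸ Finset.mem_insert_self i _
    rcases Finset.mem_insert.1 this with h | h
    · exact h
    · exact absurd h hi
  have h4 : shiftInv i c.2 ≠ c.2 := by
    have := shift_ne_self hn i (shiftInv i c.2)
    rw [shift_shiftInv] at this
    exact this.symm
  obtain rfl : a = b := by
    cases a <;> cases b <;> first | rfl | exact absurd h2 h4 | exact absurd h2.symm h4
  rfl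

variable [∀ i, NeZero (n i)]

/-- The direction sets differ in size by one, so exactly one direction `j` is missing in `a`, and
only there may the base points differ. -/
theorem incident_iff {a : Cube n d} {b : Cube n (d + 1)} : Incident n d a b ↔
    ∃ j ∈ b.1.1, a.1.1 = b.1.1.erase j ∧ (a.2 = b.2 ∨ a.2 = shift j b.2) := by
  rw [Incident, carrier_subset_iff]
  constructor
  · rintro ⟨hs, hv⟩
    have hcard : (b.1.1 \ a.1.1).card = 1 := by
      rw [Finset.card_sdiff_of_subset hs, a.1.2, b.1.2]
      omega
    obtain ⟨j, hj⟩ := Finset.card_eq_one.1 hcard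
    have hjm : j ∈ b.1.1 \ a.1.1 := hj ▸ Finset.mem_singleton_self j
    have huniq : ∀ i, i ∈ b.1.1 → i ∉ a.1.1 → i = j := fun i h1 h2 =>
      Finset.mem_singleton.1 (hj ▸ Finset.mem_sdiff.2 ⟨h1, h2⟩)
    obtain ⟨hjb, hja⟩ := Finset.mem_sdiff.1 hjm
    refine ⟨j, hjb, ?_, ?_⟩
    · ext i
      rw [Finset.mem_erase]
      exact ⟨fun h => ⟨fun e => hja (e ▸ h), hs h⟩, fun h => by
        by_contra h2
        exact h.1 (huniq i h.2 h2)⟩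
    · have hne : ∀ i, i ≠ j → a.2 i = b.2 i := fun i hi => by
        rcases hv i with h | ⟨h1, h2, -⟩
        · exact h
        · exact absurd (huniq i h2 h1) hi
      rcases hv j with h | ⟨-, -, h⟩
      · left
        funext i
        by_cases hi : i = j
        · rw [hi, h]
        · exact hne i hi
      · right
        funext i
        by_cases hi : i = j
        · rw [hi, h, shift_apply_self]
        · rw [shift_apply_of_ne hi, hne i hi]
  · rintro ⟨j, hj, h1, h2⟩
    refine ⟨h1 ▸ Finset.erase_subset _ _, fun i => ?_⟩
    rcases h2 with h2 | h2
    · exact Or.inl (congrFun h2 i)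
    · by_cases hi : i = j
      · subst hi
        exact Or.inr ⟨by rw [h1]; simp, hj, by rw [h2, shift_apply_self]⟩
      · exact Or.inl (by rw [h2, shift_apply_of_ne hi])

theorem incident_iff_exists_face {a : Cube n d} {b : Cube n (d + 1)} :
    Incident n d a b ↔ ∃ p, face b p = a := by
  rw [incident_iff]
  constructor
  · rintro ⟨j, hj, h1, h2 | h2⟩
    · exact ⟨⟨⟨j, hj⟩, false⟩, Prod.ext (Subtype.ext h1.symm) h2.symm⟩
    · exact ⟨⟨⟨j, hj⟩, true⟩, Prod.ext (Subtype.ext h1.symm) h2.symm⟩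
  · rintro ⟨⟨⟨j, hj⟩, s⟩, rfl⟩
    refine ⟨j, hj, rfl, ?_⟩
    cases s
    · exact Or.inl rfl
    · exact Or.inr rfl

theorem incident_iff_exists_coface {a : Cube n d} {b : Cube n (d + 1)} :
    Incident n d a b ↔ ∃ p, coface a p = b := by
  rw [incident_iff]
  constructor
  · rintro ⟨j, hj, h1, h2⟩
    have hja : j ∉ a.1.1 := by rw [h1]; simp
    have h3 : insert j a.1.1 = b.1.1 := by rw [h1, Finset.insert_erase hj]
    rcases h2 with h2 | h2
    · exact ⟨⟨⟨j, hja⟩, false⟩, Prod.ext (Subtype.ext h3) h2⟩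
    · refine ⟨⟨⟨j, hja⟩, true⟩, Prod.ext (Subtype.ext h3) ?_⟩
      change shiftInv j a.2 = b.2
      rw [h2, shiftInv_shift]
  · rintro ⟨⟨⟨j, hj⟩, s⟩, rfl⟩
    refine ⟨j, Finset.mem_insert_self _ _, (Finset.erase_insert hj).symm, ?_⟩
    cases s
    · exact Or.inl rfl
    · exact Or.inr (shift_shiftInv j a.2).symm

/-- The cubes contained in a given cube. -/
noncomputable def faceEquiv (hn : ∀ i, 2 ≤ n i) (b : Cube n (d + 1)) :
    {j // j ∈ b.1.1} × Bool ≃ {a : Cube n d // Incident n d a b} :=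
  Equiv.ofBijective (fun p => ⟨face b p, incident_iff_exists_face.2 ⟨p, rfl⟩⟩)
    ⟨fun _ _ h => face_injective hn b (congrArg Subtype.val h), fun a => by
      obtain ⟨p, hp⟩ := incident_iff_exists_face.1 a.2
      exact ⟨p, Subtype.ext hp⟩⟩

/-- The cubes containing a given cube. -/
noncomputable def cofaceEquiv (hn : ∀ i, 2 ≤ n i) (a : Cube n d) :
    {j // j ∉ a.1.1} × Bool ≃ {b : Cube n (d + 1) // Incident n d a b} :=
  Equiv.ofBijective (fun p => ⟨coface a p, incident_iff_exists_coface.2 ⟨p, rfl⟩⟩)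
    ⟨fun _ _ h => coface_injective hn a (congrArg Subtype.val h), fun b => by
      obtain ⟨p, hp⟩ := incident_iff_exists_coface.1 b.2
      exact ⟨p, Subtype.ext hp⟩⟩

variable [DecidableRel (Incident n d)]

theorem card_faces (hn : ∀ i, 2 ≤ n i) (b : Cube n (d + 1)) :
    Fintype.card {a : Cube n d // Incident n d a b} = (d + 1) * 2 := by
  rw [← Fintype.card_congr (faceEquiv hn b), Fintype.card_prod, Fintype.card_bool,
    Fintype.card_coe, b.1.2]

theorem card_cofaces (hn : ∀ i, 2 ≤ n i) (a : Cube n d) :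
    Fintype.card {b : Cube n (d + 1) // Incident n d a b} = (q - d) * 2 := by
  rw [← Fintype.card_congr (cofaceEquiv hn a), Fintype.card_prod, Fintype.card_bool,
    Fintype.card_subtype_compl, Fintype.card_coe, a.1.2, Fintype.card_fin]

theorem incid_eq_toLin' (hn : ∀ i, 2 ≤ n i) :
    incid n d = Matrix.toLin' (incMatrix (Incident n d)) := by
  refine LinearMap.ext fun f => funext fun b => ?_
  rw [Matrix.toLin'_apply, Matrix.mulVec, dotProduct]
  simp only [incMatrix, Matrix.of_apply, ite_mul, one_mul, zero_mul]
  rw [← Finset.sum_filter, Finset.sum_subtype (p := fun a => Incident n d a b) _ (by simp) f,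
    ← (faceEquiv hn b).sum_comp, Fintype.sum_prod_type]
  refine Finset.sum_congr rfl fun j _ => ?_
  rw [Fintype.sum_bool, add_comm]
  rfl

theorem incidStar_eq_toLin' (hn : ∀ i, 2 ≤ n i) :
    incidStar n d = Matrix.toLin' (incMatrix (Incident n d)).transpose := by
  refine LinearMap.ext fun f => funext fun a => ?_
  rw [Matrix.toLin'_apply, Matrix.mulVec, dotProduct]
  simp only [incMatrix, Matrix.of_apply, Matrix.transpose_apply, ite_mul, one_mul, zero_mul]
  rw [← Finset.sum_filter, Finset.sum_subtype (p := fun b => Incident n d a b) _ (by simp) f,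
    ← (cofaceEquiv hn a).sum_comp, Fintype.sum_prod_type]
  change ∑ j : {j : Fin q // j ∉ a.1.1},
    (f (a.1.add j, a.2) + f (a.1.add j, shiftInv j.1 a.2)) = _
  refine Finset.sum_congr rfl fun j _ => ?_
  rw [Fintype.sum_bool, add_comm]
  rfl

end CubicalLattice

/-! ### Fourier decomposition of the cochains -/

theorem Matrix.det_blockDiagonal' {ι R : Type*} [Fintype ι] [DecidableEq ι] [CommRing R]
    {m : ι → Type*} [∀ i, Fintype (m i)] [∀ i, DecidableEq (m i)]
    (M : ∀ i, Matrix (m i) (m i) R) :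
    (Matrix.blockDiagonal' M).det = ∏ i, (M i).det := by
  let _ : LinearOrder ι := IsWellOrder.linearOrder WellOrderingRel
  rw [(Matrix.blockTriangular_blockDiagonal' M).det_fintype]
  refine Finset.prod_congr rfl fun k _ => ?_
  rw [← Matrix.det_submatrix_equiv_self (Equiv.sigmaSubtype k).symm]
  congr 1
  ext i j
  exact Matrix.blockDiagonal'_apply_eq M k i j

/-- In a basis adapted to the decomposition the matrix is block diagonal. -/
theorem LinearMap.det_eq_prod_det_restrict {ι R M : Type*} [Fintype ι] [DecidableEq ι] [CommRing R]
    [AddCommGroup M] [Module R M] {N : ι → Submodule R M} [∀ i, Module.Finite R (N i)]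
    [∀ i, Module.Free R (N i)] (h : DirectSum.IsInternal N) {f : M →ₗ[R] M}
    (hf : ∀ i, Set.MapsTo f (N i) (N i)) :
    LinearMap.det f = ∏ i, LinearMap.det (f.restrict (hf i)) := by
  classical
  let b : (i : ι) → Module.Basis _ R (N i) := fun i => Module.Free.chooseBasis R (N i)
  rw [← LinearMap.det_toMatrix (h.collectedBasis b),
    LinearMap.toMatrix_directSum_collectedBasis_eq_blockDiagonal' h h b b hf,
    Matrix.det_blockDiagonal']
  simp_rw [LinearMap.det_toMatrix]

namespace CubicalLattice

variable {q : ℕ} (n : Fin q → ℕ) (d : ℕ)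

/-- The action of a shift on cochains. -/
def shiftOp (j : Fin q) : Module.End ℂ (Cochain n d) where
  toFun f c := f (c.1, shift j c.2)
  map_add' _ _ := rfl
  map_smul' _ _ := rfl

theorem shiftOp_commute (i j : Fin q) : Commute (shiftOp n d i) (shiftOp n d j) := by
  refine LinearMap.ext fun f => funext fun c => ?_
  change f (c.1, shift j (shift i c.2)) = f (c.1, shift i (shift j c.2))
  congr 2
  simp only [shift]
  abel

theorem fiber_le_iInf_maxGenEigenspace (z : DualGroup n) :
    fiber n d z ≤ ⨅ j, (shiftOp n d j).maxGenEigenspace ((z j : ℂˣ) : ℂ) := by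
  refine le_iInf fun j f hf => ?_
  refine Module.End.mem_maxGenEigenspace _ _ _ |>.2 ⟨1, ?_⟩
  refine funext fun c => ?_
  have h := hf j c.1 c.2
  simp [shiftOp, h]

/-- The shifts commute, so their joint generalized eigenspaces are independent, and distinct
characters have distinct eigenvalue systems. Independence passes to the smaller subspaces `fiber n d
z`. -/
theorem iSupIndep_fiber : iSupIndep (fiber n d) := by
  have h := Module.End.independent_iInf_maxGenEigenspace_of_forall_mapsTo (shiftOp n d)
    fun i j φ => Module.End.mapsTo_maxGenEigenspace_of_comm (shiftOp_commute n d j i) φ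
  have hinj : Function.Injective fun (z : DualGroup n) j => ((z j : ℂˣ) : ℂ) := by
    intro z w hzw
    funext j
    exact Subtype.ext (Units.ext (congrFun hzw j))
  exact (h.comp hinj).mono (fiber_le_iInf_maxGenEigenspace n d)

variable {n} in
/-- The character of `V` with the given values at the generators. -/
noncomputable def character (z : DualGroup n) (v : Torus n) : ℂ :=
  ∏ i, ((z i : ℂˣ) : ℂ) ^ (v i).val

theorem character_ne_zero (z : DualGroup n) (v : Torus n) : character z v ≠ 0 :=
  Finset.prod_ne_zero_iff.2 fun _ _ => pow_ne_zero _ (Units.ne_zero _)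

variable [∀ i, NeZero (n i)]

variable {n} in
theorem character_shift (z : DualGroup n) (j : Fin q) (v : Torus n) :
    character z (shift j v) = ((z j : ℂˣ) : ℂ) * character z v := by
  have hz : ((z j : ℂˣ) : ℂ) ^ n j = 1 := by
    rw [← Units.val_pow_eq_pow_val, (mem_rootsOfUnity _ _).1 (z j).2, Units.val_one]
  have h1 : ∀ v : Torus n, character z v = ((z j : ℂˣ) : ℂ) ^ (v j).val *
      ∏ i ∈ Finset.univ.erase j, ((z i : ℂˣ) : ℂ) ^ (v i).val :=
    fun v => (Finset.mul_prod_erase _ _ (Finset.mem_univ j)).symm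
  have h2 : (v j + 1).val = ((v j).val + 1) % n j := by
    rw [← ZMod.val_natCast]
    simp
  rw [h1, h1 v, shift_apply_self, h2, ← pow_eq_pow_mod _ hz, pow_succ', mul_assoc]
  congr 2
  refine Finset.prod_congr rfl fun i hi => ?_
  rw [shift_apply_of_ne (Finset.ne_of_mem_erase hi)]

/-- Cochains with a given twist from functions on the directions. -/
noncomputable def fiberOfCell (z : DualGroup n) : (Cell q d → ℂ) →ₗ[ℂ] fiber n d z where
  toFun g := ⟨fun c => g c.1 * character z c.2, fun j σ v => by
    change g σ * character z (shift j v) = _ * (g σ * character z v)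
    rw [character_shift]
    ring⟩
  map_add' _ _ := Subtype.ext (funext fun _ => add_mul _ _ _)
  map_smul' _ _ := Subtype.ext (funext fun _ => mul_assoc _ _ _)

theorem card_le_finrank_fiber (z : DualGroup n) :
    Fintype.card (Cell q d) ≤ Module.finrank ℂ (fiber n d z) := by
  rw [← Module.finrank_fintype_fun_eq_card ℂ]
  refine LinearMap.finrank_le_finrank_of_injective (f := fiberOfCell n d z) fun g g' h => ?_
  funext σ
  have h1 := congrFun (congrArg Subtype.val h) (σ, 0)
  exact mul_right_cancel₀ (character_ne_zero n z 0) h1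

theorem card_dualGroup : Fintype.card (DualGroup n) = Fintype.card (Torus n) := by
  rw [← Nat.card_eq_fintype_card, Nat.card_pi, Fintype.card_pi]
  exact Finset.prod_congr rfl fun i _ => by rw [Complex.card_rootsOfUnity, ZMod.card]

/-- Independence gives injectivity. Surjectivity is a dimension count: there are |V| characters, and
each fiber has at least the dimension of the functions on `Cell q d`. -/
theorem isInternal_fiber [DecidableEq (DualGroup n)] : DirectSum.IsInternal (fiber n d) := by
  have hinj : Function.Injective (DirectSum.coeLinearMap (fiber n d)) :=
    (iSupIndep_fiber n d).dfinsupp_lsum_injective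
  have h1 := LinearMap.finrank_le_finrank_of_injective hinj
  have h2 : Module.finrank ℂ (Cochain n d) ≤
      Module.finrank ℂ (DirectSum (DualGroup n) fun z => fiber n d z) := by
    rw [Module.finrank_directSum, Module.finrank_fintype_fun_eq_card, Fintype.card_prod,
      ← card_dualGroup, mul_comm, ← smul_eq_mul, ← Finset.card_univ, ← Finset.sum_const]
    exact Finset.sum_le_sum fun z _ => card_le_finrank_fiber n d z
  have hsurj : Function.Surjective (DirectSum.coeLinearMap (fiber n d)) :=
    LinearMap.range_eq_top.1 (Submodule.eq_top_of_finrank_eq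
      ((LinearMap.finrank_range_of_inj hinj).trans (h1.antisymm h2)))
  exact ⟨hinj, hsurj⟩

/-- The global operator preserves every fiber, and its restriction is the twisted one by definition.
-/
theorem prod_det_upAdj (c u : ℂ) :
    ∏ z : DualGroup n, LinearMap.det (c • LinearMap.id - u • upAdj n d z) =
      LinearMap.det (c • LinearMap.id - u • (incidStar n d ∘ₗ incid n d)) := by
  classical
  have hf : ∀ z : DualGroup n, Set.MapsTo
      ⇑(c • LinearMap.id - u • (incidStar n d ∘ₗ incid n d) : Cochain n d →ₗ[ℂ] Cochain n d)
      (fiber n d z) (fiber n d z) := by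
    intro z f hf
    change c • f - u • incidStar n d (incid n d f) ∈ fiber n d z
    exact (fiber n d z).sub_mem ((fiber n d z).smul_mem c hf)
      ((fiber n d z).smul_mem u (incidStar_mem_fiber _ (incid_mem_fiber f hf)))
  rw [LinearMap.det_eq_prod_det_restrict (isInternal_fiber n d) hf]
  rfl

theorem prod_det_downAdj (c u : ℂ) :
    ∏ z : DualGroup n, LinearMap.det (c • LinearMap.id - u • downAdj n (d + 1) z) =
      LinearMap.det (c • LinearMap.id - u • (incid n d ∘ₗ incidStar n d)) := by
  classical
  have hf : ∀ z : DualGroup n, Set.MapsTo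
      ⇑(c • LinearMap.id - u • (incid n d ∘ₗ incidStar n d) :
        Cochain n (d + 1) →ₗ[ℂ] Cochain n (d + 1)) (fiber n (d + 1) z) (fiber n (d + 1) z) := by
    intro z f hf
    change c • f - u • incid n d (incidStar n d f) ∈ fiber n (d + 1) z
    exact (fiber n (d + 1) z).sub_mem ((fiber n (d + 1) z).smul_mem c hf)
      ((fiber n (d + 1) z).smul_mem u (incid_mem_fiber _ (incidStar_mem_fiber f hf)))
  rw [LinearMap.det_eq_prod_det_restrict (isInternal_fiber n (d + 1)) hf]
  rfl

end CubicalLattice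

/-! ### The determinant formula for the zeta function -/

namespace CubicalLattice

open Subshift

variable {q : ℕ} (n : Fin q → ℕ) (d : ℕ)

theorem PrimeCycle.length_pos {n : Fin q → ℕ} {d : ℕ} (p : PrimeCycle n d) : 0 < p.length := by
  induction p using Quotient.inductionOn with
  | h c => exact c.1.length_pos

variable [∀ i, NeZero (n i)]

set_option synthInstance.maxSize 1000 in
/-- The Bowen–Lanford formula for the zeta function. -/
theorem exists_zeta_inv_eq_det [DecidableRel (Incident n d)] :
    ∃ r : ℝ, 0 < r ∧ ∀ u : ℂ, ‖u‖ < r →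
      Multipliable (fun p : PrimeCycle n (d + 1) => (1 - u ^ p.length)⁻¹) ∧
      zeta n (d + 1) u ≠ 0 ∧
      (zeta n (d + 1) u)⁻¹ = (1 - u • (Matrix.of fun f g : IncidentPair (Incident n d) =>
        if GeodesicStep (Incident n d) f g then (1 : ℂ) else 0)).det := by
  obtain ⟨r, hr, h⟩ := Matrix.exists_hasSum_trace_pow
    (Matrix.of fun f g : IncidentPair (Incident n d) =>
      if GeodesicStep (Incident n d) f g then (1 : ℂ) else 0)
  refine ⟨min r 1, lt_min hr one_pos, fun u hu => ?_⟩
  have hu1 : ‖u‖ < 1 := hu.trans_le (min_le_right _ _)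
  obtain ⟨s, hs, hdet⟩ := h u (hu.trans_le (min_le_left _ _))
  -- The coefficients are counts, hence nonnegative, so convergence at `‖u‖` is absolute convergence
  -- at `u`.
  obtain ⟨s', hs', -⟩ := h (‖u‖ : ℂ) (by simpa using hu.trans_le (min_le_left _ _))
  simp only [card_isPeriodicPt_shiftPerm] at hs hs'
  have hfin : ∀ m : ℕ, Finite {x : GeodesicSeq n d //
      Function.IsPeriodicPt (shiftPerm (GeodesicStep (Incident n d))) (m + 1) x} := fun m =>
    Finite.of_equiv _ (periodicEquiv (GeodesicStep (Incident n d)) m).symm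
  have hsum := Equiv.Perm.hasSum_neg_log_one_sub_pow (shiftPerm (GeodesicStep (Incident n d)))
    hfin primeCycleOfPeriodic primeCycleOfPeriodic_surjective primeCycleOfPeriodic_eq_iff
    PrimeCycle.length primeCycleOfPeriodic_length hu1 hs (by
      refine hs'.summable.norm.congr fun m => ?_
      rw [norm_div, norm_mul, norm_pow, Complex.norm_natCast, Complex.norm_real, norm_norm]
      congr 1
      exact_mod_cast Complex.norm_natCast (m + 1))
  have hnorm : ∀ p : PrimeCycle n (d + 1), ‖u ^ p.length‖ < 1 := fun p => by
    rw [norm_pow]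
    exact pow_lt_one₀ (norm_nonneg _) hu1 p.length_pos.ne'
  have hslit : ∀ p : PrimeCycle n (d + 1), 1 - u ^ p.length ∈ Complex.slitPlane := fun p => by
    rw [sub_eq_add_neg]
    exact Complex.mem_slitPlane_of_norm_lt_one (by rw [norm_neg]; exact hnorm p)
  have hprod : HasProd (fun p : PrimeCycle n (d + 1) => (1 - u ^ p.length)⁻¹) (Complex.exp s) := by
    refine Complex.hasProd_of_hasSum_log
      (fun p => inv_ne_zero (Complex.slitPlane_ne_zero (hslit p))) (hsum.congr_fun fun p => ?_)
    exact Complex.log_inv _ (Complex.mem_slitPlane_iff_arg.1 (hslit p)).1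
  have hz : zeta n (d + 1) u = Complex.exp s := hprod.tprod_eq
  refine ⟨hprod.multipliable, hz ▸ Complex.exp_ne_zero s, ?_⟩
  rw [hz, ← Complex.exp_neg, hdet]

theorem card_cube : Fintype.card (Cube n d) = q.choose d * ∏ i, n i := by
  rw [Fintype.card_prod, Fintype.card_finset_len, Fintype.card_fin, Fintype.card_pi]
  simp [ZMod.card]

variable {n d}

theorem card_incidentPair [DecidableRel (Incident n d)] (hn : ∀ i, 2 ≤ n i) :
    Fintype.card (IncidentPair (Incident n d)) =
      q.choose (d + 1) * (∏ i, n i) * ((d + 1) * 2) := by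
  let e : IncidentPair (Incident n d) ≃ (b : Cube n (d + 1)) × {a : Cube n d // Incident n d a b} :=
    { toFun := fun p => ⟨p.1.2, p.1.1, p.2⟩
      invFun := fun p => ⟨(p.2.1, p.1), p.2.2⟩
      left_inv := fun _ => rfl
      right_inv := fun _ => rfl }
  rw [Fintype.card_congr e, Fintype.card_sigma, Finset.sum_congr rfl fun b _ => card_faces hn b,
    Finset.sum_const, Finset.card_univ, card_cube, smul_eq_mul]

theorem prod_det_upAdj_eq_det [DecidableRel (Incident n d)] (hn : ∀ i, 2 ≤ n i) (c u : ℂ) :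
    ∏ z : DualGroup n, LinearMap.det (c • LinearMap.id - u • upAdj n d z) =
      (c • (1 : Matrix (Cube n d) (Cube n d) ℂ) -
        u • ((incMatrix (Incident n d)).transpose * incMatrix (Incident n d))).det := by
  have h : c • LinearMap.id - u • (incidStar n d ∘ₗ incid n d) =
      Matrix.toLin' (c • (1 : Matrix (Cube n d) (Cube n d) ℂ) -
        u • ((incMatrix (Incident n d)).transpose * incMatrix (Incident n d))) := by
    rw [map_sub, map_smul, map_smul, Matrix.toLin'_one, Matrix.toLin'_mul, incid_eq_toLin' hn,
      incidStar_eq_toLin' hn]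
  rw [prod_det_upAdj, h, LinearMap.det_toLin']

theorem prod_det_downAdj_eq_det [DecidableRel (Incident n d)] (hn : ∀ i, 2 ≤ n i) (c u : ℂ) :
    ∏ z : DualGroup n, LinearMap.det (c • LinearMap.id - u • downAdj n (d + 1) z) =
      (c • (1 : Matrix (Cube n (d + 1)) (Cube n (d + 1)) ℂ) -
        u • (incMatrix (Incident n d) * (incMatrix (Incident n d)).transpose)).det := by
  have h : c • LinearMap.id - u • (incid n d ∘ₗ incidStar n d) =
      Matrix.toLin' (c • (1 : Matrix (Cube n (d + 1)) (Cube n (d + 1)) ℂ) -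
        u • (incMatrix (Incident n d) * (incMatrix (Incident n d)).transpose)) := by
    rw [map_sub, map_smul, map_smul, Matrix.toLin'_one, Matrix.toLin'_mul, incid_eq_toLin' hn,
      incidStar_eq_toLin' hn]
  rw [prod_det_downAdj, h, LinearMap.det_toLin']

end CubicalLattice

/-! ### Exponents and the final formula -/

theorem one_add_mul_ne_zero {a u : ℂ} {r : ℝ} (ha : ‖a‖ ≤ r) (hu : ‖u‖ < (r + 1)⁻¹) :
    1 + a * u ≠ 0 := by
  intro h
  have hr : 0 ≤ r := (norm_nonneg a).trans ha
  have h1 : ‖a * u‖ = 1 := by rw [eq_neg_of_add_eq_zero_right h, norm_neg, norm_one]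
  rw [norm_mul] at h1
  have h2 : ‖u‖ * (r + 1) < 1 := by
    rwa [← lt_div_iff₀ (by positivity), one_div]
  nlinarith [norm_nonneg u, norm_nonneg a, mul_le_mul_of_nonneg_right ha (norm_nonneg u)]

theorem pow_mul_inv_pow_eq_zpow {x : ℂ} (hx : x ≠ 0) {a b : ℕ} {k : ℤ} (h : k = a - b) :
    x ^ a * (x ^ b)⁻¹ = x ^ k := by
  rw [h, zpow_sub₀ hx, zpow_natCast, zpow_natCast, div_eq_mul_inv]

set_option synthInstance.maxSize 1000 in
theorem mainTheorem2 (q d : ℕ) (hd : 1 ≤ d) (hdq : d ≤ q) (n : Fin q → ℕ)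
    [∀ i, NeZero (n i)] (hn : ∀ i, 2 ≤ n i)
    (N : ℕ) (hN : N = ∏ i, n i)
    (α β γ κ : ℤ) (hα : α = 2 * q - 2 * d + 1) (hβ : β = 2 * d - 1)
    (hγ : γ = (q.choose d : ℤ) - q.choose (d - 1))
    (hκ : κ = ((q : ℤ) - d) * q.choose (d - 1) + ((d : ℤ) - 1) * q.choose d) :
    ∃ r : ℝ, 0 < r ∧ ∀ u : ℂ, ‖u‖ < r →
      Multipliable (fun p : PrimeCycle n d => (1 - u ^ p.length)⁻¹) ∧
      zeta n d u ≠ 0 ∧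
      (zeta n d u)⁻¹ =
        (1 - u) ^ (κ * N) * (1 + β * u) ^ (γ * N) *
          ∏ z : DualGroup n,
            LinearMap.det (((1 + α * u) * (1 + β * u)) • LinearMap.id - u • upAdj n (d - 1) z) ∧
      (zeta n d u)⁻¹ =
        (1 - u) ^ (κ * N) * (1 + α * u) ^ (-γ * N) *
          ∏ z : DualGroup n,
            LinearMap.det (((1 + α * u) * (1 + β * u)) • LinearMap.id - u • downAdj n d z) := by
  classical
  obtain ⟨d, rfl⟩ : ∃ e, d = e + 1 := ⟨d - 1, by omega⟩
  simp only [Nat.add_sub_cancel] at hγ hκ ⊢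
  obtain ⟨r, hr, h⟩ := exists_zeta_inv_eq_det n d
  -- Since |α|, |β| and 1 are at most 2q, this radius keeps 1 + αu, 1 + βu and 1 - u away from zero,
  -- as integer powers with possibly negative exponents require.
  refine ⟨min r (2 * q + 1 : ℝ)⁻¹, lt_min hr (by positivity), fun u hu => ?_⟩
  obtain ⟨hmul, hne, hz⟩ := h u (hu.trans_le (min_le_left _ _))
  have hu' : ‖u‖ < (2 * q + 1 : ℝ)⁻¹ := hu.trans_le (min_le_right _ _)
  have hα0 : 1 + (α : ℂ) * u ≠ 0 := by
    refine one_add_mul_ne_zero ?_ hu'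
    rw [Complex.norm_intCast]
    exact_mod_cast abs_le.2 (by constructor <;> omega : -(2 * (q : ℤ)) ≤ α ∧ α ≤ 2 * q)
  have hβ0 : 1 + (β : ℂ) * u ≠ 0 := by
    refine one_add_mul_ne_zero ?_ hu'
    rw [Complex.norm_intCast]
    exact_mod_cast abs_le.2 (by constructor <;> omega : -(2 * (q : ℤ)) ≤ β ∧ β ≤ 2 * q)
  have hu0 : 1 - u ≠ 0 := by
    have h1 : 1 + (-1) * u ≠ 0 := by
      refine one_add_mul_ne_zero ?_ hu'
      rw [norm_neg, norm_one]
      exact_mod_cast (by omega : 1 ≤ 2 * q)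
    rwa [neg_one_mul, ← sub_eq_add_neg] at h1
  have hA : ∀ a : Cube n d, (Fintype.card {b // Incident n d a b} : ℂ) = α + 1 := by
    intro a
    rw [card_cofaces hn, hα]
    push_cast [Nat.cast_sub (by omega : d ≤ q)]
    ring
  have hB : ∀ b : Cube n (d + 1), (Fintype.card {a // Incident n d a b} : ℂ) = β + 1 := by
    intro b
    rw [card_faces hn, hβ]
    push_cast
    ring
  have hdown := Matrix.det_smul_one_sub_smul_mul_comm (incMatrix (Incident n d))
    (incMatrix (Incident n d)).transpose (mul_ne_zero hα0 hβ0) u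
  have hchoose : ((q.choose (d + 1) : ℤ)) * (d + 1) = q.choose d * (q - d) := by
    have := Nat.choose_succ_right_eq q d
    zify [(by omega : d ≤ q)] at this
    exact this
  -- The exponent is the number of flags minus the number of vertices. Half of the flag count is
  -- rewritten from `d`-cubes to `(d-1)`-cubes by `hchoose`, giving the symmetric form of κ.
  have e1 : (1 - u) ^ Fintype.card (IncidentPair (Incident n d)) *
      ((1 - u) ^ (Fintype.card (Cube n d) + Fintype.card (Cube n (d + 1))))⁻¹ =
      (1 - u) ^ (κ * N) := by
    refine pow_mul_inv_pow_eq_zpow hu0 ?_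
    rw [card_incidentPair hn, card_cube, card_cube, ← hN, hκ]
    push_cast
    linear_combination (-(N : ℤ)) * hchoose
  have e2 : ∀ x : ℂ, x ≠ 0 → x ^ Fintype.card (Cube n (d + 1)) * (x ^ Fintype.card (Cube n d))⁻¹ =
      x ^ (γ * N) := by
    intro x hx
    refine pow_mul_inv_pow_eq_zpow hx ?_
    rw [card_cube, card_cube, ← hN, hγ]
    push_cast
    ring
  have hup : (zeta n (d + 1) u)⁻¹ =
      (1 - u) ^ (κ * N) * (1 + β * u) ^ (γ * N) *
        (((1 + α * u) * (1 + β * u)) • (1 : Matrix (Cube n d) (Cube n d) ℂ) -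
          u • ((incMatrix (Incident n d)).transpose * incMatrix (Incident n d))).det := by
    rw [hz, det_one_sub_smul_geodesicStep _ hA hB hu0 hβ0, e1, e2 _ hβ0]
  refine ⟨hmul, hne, ?_, ?_⟩
  · rw [hup, ← prod_det_upAdj_eq_det hn]
    rfl
  -- Exchanging the two products costs the factor ((1 + αu)(1 + βu))^(γN); its α-part cancels the
  -- prefactor and its β-part is the one in `hup`.
  · rw [prod_det_downAdj_eq_det hn, hup, hdown, e2 _ (mul_ne_zero hα0 hβ0), mul_zpow, neg_mul,
      zpow_neg]
    have h1 := inv_mul_cancel₀ (zpow_ne_zero (γ * N) hα0)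
    linear_combination (-((1 - u) ^ (κ * N) * (1 + β * u) ^ (γ * N) *
      (((1 + α * u) * (1 + β * u)) • (1 : Matrix (Cube n d) (Cube n d) ℂ) -
        u • ((incMatrix (Incident n d)).transpose * incMatrix (Incident n d))).det)) * h1
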